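/- Let $2<q<\infty$ and let $\alpha\in\mathbb R$ satisfy $(q+2)\alpha^2\le 1$. (a) Consider all pairs $(r,\varphi)$ where $r\ge 0$ is a $2\pi$-periodic absolutely continuous function with $\int_0^{2\pi} r^q\,dx=2\pi$, and $\varphi$ is a real-valued, locally absolutely continuous function whose derivative $\varphi'$ is $2\pi$-periodic with $\int_0^{2\pi}\varphi'\,dx=2\pi\alpha$. Among all such pairs the functional $$J(r,\varphi)=\int_0^{2\pi}\bigl(r'^2+r^2\varphi'^2\bigr)\,dx\in[0,\infty]$$ attains its minimum at $r\equiv 1$ (with $\varphi(x)=\alpha x$). (b) Let $A\in L_1(0,2\pi)$ be real-valued with mean value $\frac1{2\pi}\int_0^{2\pi}A\,dx\in\alpha+\mathbb Z$, and put $$\mu_q(A)=\min_u\frac{\|u'+iAu\|_{L_2(0,2\pi)}}{\|u\|_{L_q(0,2\pi)}},$$ where $u\not\equiv 0$ runs over all complex-valued $2\pi$-periodic absolutely continuous functions (the numerator is $+\infty$ if $u'+iAu\notin L_2$). Then the minimum is attained and $$\mu_q(A)=(2\pi)^{\frac12-\frac1q}\,|\alpha|.$$ -/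

import Mathlib

open MeasureTheory

noncomputable section

namespace Magnetic

/-- The competitors in the embedding problem: nonzero, `2π`-periodic, absolutely continuous,
complex-valued functions. -/
structure IsCompetitor (u : ℝ → ℂ) : Prop where
  periodic : Function.Periodic u (2 * Real.pi)
  absCont : AbsolutelyContinuousOnInterval u 0 (2 * Real.pi)
  ne_zero : u ≠ 0

/-- The quotient `‖u' + i A u‖_{L₂(0,2π)} / ‖u‖_{L_q(0,2π)}`, with values in `[0, ∞]`
(the numerator is infinite if `u' + i A u` is not square integrable). -/
def quotient (q : ℝ) (A : ℝ → ℝ) (u : ℝ → ℂ) : ENNReal :=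
  eLpNorm (fun x => deriv u x + Complex.I * (A x : ℂ) * u x) 2
      (volume.restrict (Set.Ioc 0 (2 * Real.pi))) /
    eLpNorm u (ENNReal.ofReal q) (volume.restrict (Set.Ioc 0 (2 * Real.pi)))

/-- The sharp constant `μ_q(A)`: the infimum of the quotient over all competitors. -/
def mu (q : ℝ) (A : ℝ → ℝ) : ENNReal :=
  sInf (quotient q A '' {u | IsCompetitor u})

/-- The mean value of `A` over `(0, 2π)`. -/
def mean (A : ℝ → ℝ) : ℝ :=
  (1 / (2 * Real.pi)) * ∫ x in (0 : ℝ)..(2 * Real.pi), A x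

/-- The pairs `(r, φ)` admissible in the polar problem: `r ≥ 0` is `2π`-periodic and absolutely
continuous with `∫ r ^ q = 2π`; `φ` is locally absolutely continuous, `φ'` is `2π`-periodic, and
`∫ φ' = 2πα`. -/
structure PolarAdmissible (q α : ℝ) (r φ : ℝ → ℝ) : Prop where
  r_nonneg : ∀ x, 0 ≤ r x
  r_periodic : Function.Periodic r (2 * Real.pi)
  r_absCont : AbsolutelyContinuousOnInterval r 0 (2 * Real.pi)
  r_normalized : ∫ x in (0 : ℝ)..(2 * Real.pi), r x ^ q = 2 * Real.pi
  phi_absCont : ∀ a b : ℝ, AbsolutelyContinuousOnInterval φ a b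
  phi_deriv_periodic : Function.Periodic (deriv φ) (2 * Real.pi)
  phi_increment : ∫ x in (0 : ℝ)..(2 * Real.pi), deriv φ x = 2 * Real.pi * α

/-- The functional `J(r, φ) = ∫ (r'² + r² φ'²)` over `(0, 2π)`, with values in `[0, ∞]`. -/
def J (r φ : ℝ → ℝ) : ENNReal :=
  ∫⁻ x in Set.Ioc 0 (2 * Real.pi),
    ENNReal.ofReal (deriv r x ^ 2 + r x ^ 2 * deriv φ x ^ 2)

end Magnetic

end

/-!
# The sharp magnetic Sobolev constant on the circle

For `α = 0` the lower bounds are trivial. For `α ≠ 0` the lower bound is a convex combination, with the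
weights `4 α²` and `1 - 4 α²`, of two sharp inequalities for the modulus `r`.

* `half_flux_inequality`: `α² ∫ r² ≤ 4 α² ∫ r'² + ∫ r² φ'²` if `φ` increases by `2πα`. Indeed
  `r exp (i φ / (2 α))` is antiperiodic, and Wirtinger's inequality with the constant `1 / 4` holds
  for antiperiodic functions. More generally (`wirtinger_of_zero`) a function on
  `[a, b]` that vanishes somewhere and has equal moduli at the end points satisfies Wirtinger's
  inequality with the Dirichlet constant; this is shown by completing a square with a tangent.
* `sobolev_circle`: `(2π) ^ (1 - 2 / q) (∫ r ^ q) ^ (2 / q) ≤ ∫ r² + (q - 2) ∫ r'²`. If `f = r ^ q`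
  evolves by the linear heat equation, then `∫ f` is conserved and the right-hand side decreases to
  its value at the mean of `f`: its rate is
  `-2 (q - 2) ∫ (r''² - r'² + (q - 1) / 3 * r'⁴ / r²)`, and `∫ r''² ≥ ∫ r'²` is Wirtinger's
  inequality for the mean zero function `r'`. The flow is run on positive trigonometric polynomials
  `f`, where it is explicit (`heatTrig`), and the inequality extends to all `r` by density.

They combine (`energy_lower_bound`) because `1 - 4 α² ≥ (q - 2) α²` is the hypothesis
`(q + 2) α² ≤ 1`.

For the magnetic problem take `r = |u|`. If `u` vanishes somewhere, then Wirtinger's inequality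
applies to `r` itself, and the diamagnetic inequality gives the half-flux inequality with the
surplus of the magnetic energy over `∫ r'²` as potential energy. Otherwise `u` has a phase, whose
covariant derivative integrates to `2π (α + j)` with an integer `j` (`exists_winding`). As
`|α| < 1 / 2`, the flux `α + j` is at least `|α|` in modulus, so that scaling the phase down to the
flux `α` reduces the problem to the polar one. Equality holds for the gauge transform of a constant
(`exists_quotient_eq`).
-/

noncomputable section

namespace Magnetic

/-! ### Absolutely continuous functions -/

section AbsolutelyContinuous

variable {X Y : Type*} [PseudoMetricSpace X] [PseudoMetricSpace Y] {a b : ℝ}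

theorem absolutelyContinuousOnInterval_congr {f g : ℝ → X}
    (hf : AbsolutelyContinuousOnInterval f a b) (h : Set.EqOn g f (Set.uIcc a b)) :
    AbsolutelyContinuousOnInterval g a b := by
  rw [absolutelyContinuousOnInterval_iff] at hf ⊢
  intro ε hε
  obtain ⟨δ, hδ, H⟩ := hf ε hε
  refine ⟨δ, hδ, fun E hE hlen => ?_⟩
  convert H E hE hlen using 1
  refine Finset.sum_congr rfl fun i hi => ?_
  rw [h (hE.1 i hi).1, h (hE.1 i hi).2]

theorem _root_.LipschitzOnWith.comp_absolutelyContinuousOnInterval {g : X → Y} {s : Set X}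
    {K : NNReal} {f : ℝ → X} (hg : LipschitzOnWith K g s)
    (hf : AbsolutelyContinuousOnInterval f a b) (hs : Set.MapsTo f (Set.uIcc a b) s) :
    AbsolutelyContinuousOnInterval (fun x => g (f x)) a b := by
  rw [absolutelyContinuousOnInterval_iff] at hf ⊢
  intro ε hε
  obtain ⟨δ, hδ, H⟩ := hf (ε / (K + 1)) (by positivity)
  refine ⟨δ, hδ, fun E hE hlen => ?_⟩
  have h1 := H E hE hlen
  calc ∑ i ∈ Finset.range E.1, dist (g (f (E.2 i).1)) (g (f (E.2 i).2))
      ≤ ∑ i ∈ Finset.range E.1, (K + 1) * dist (f (E.2 i).1) (f (E.2 i).2) := by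
        refine Finset.sum_le_sum fun i hi => ?_
        refine (hg.dist_le_mul _ (hs (hE.1 i hi).1) _ (hs (hE.1 i hi).2)).trans ?_
        gcongr
        linarith
    _ = (K + 1) * ∑ i ∈ Finset.range E.1, dist (f (E.2 i).1) (f (E.2 i).2) := by
        rw [Finset.mul_sum]
    _ < (K + 1) * (ε / (K + 1)) := by gcongr
    _ = ε := by field_simp

theorem _root_.LipschitzWith.comp_absolutelyContinuousOnInterval {g : X → Y}
    {K : NNReal} {f : ℝ → X} (hg : LipschitzWith K g)
    (hf : AbsolutelyContinuousOnInterval f a b) :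
    AbsolutelyContinuousOnInterval (fun x => g (f x)) a b :=
  (hg.lipschitzOnWith (s := Set.univ)).comp_absolutelyContinuousOnInterval hf
    (Set.mapsTo_univ _ _)

theorem complex_ae_differentiableAt {u : ℝ → ℂ} (hu : AbsolutelyContinuousOnInterval u a b) :
    ∀ᵐ x, x ∈ Set.uIcc a b → DifferentiableAt ℝ u x :=
  hu.boundedVariationOn.ae_differentiableAt_of_mem_uIcc

end AbsolutelyContinuous

/-! ### Wirtinger inequalities -/

/-- The field `tan` calibrates the Dirichlet energy: `g'² - k² g²` is the square
`(g' + k tan (k (x - m)) g)²` minus the derivative of `k tan (k (x - m)) g²`. -/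
theorem tan_boundary_le_integral {g : ℝ → ℝ} {a b k m : ℝ} (hab : a ≤ b)
    (hg : AbsolutelyContinuousOnInterval g a b)
    (hg2 : IntervalIntegrable (fun x => deriv g x ^ 2) volume a b)
    (hk : ∀ x ∈ Set.Icc a b, |k * (x - m)| < Real.pi / 2) :
    k * Real.tan (k * (a - m)) * g a ^ 2 - k * Real.tan (k * (b - m)) * g b ^ 2 ≤
      (∫ x in a..b, deriv g x ^ 2) - k ^ 2 * ∫ x in a..b, g x ^ 2 := by
  have hcos : ∀ x ∈ Set.Icc a b, 0 < Real.cos (k * (x - m)) := fun x hx =>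
    Real.cos_pos_of_mem_Ioo (abs_lt.1 (hk x hx))
  set T : ℝ → ℝ := fun x => k * Real.tan (k * (x - m)) with hT
  set T' : ℝ → ℝ := fun x => k ^ 2 * (1 + Real.tan (k * (x - m)) ^ 2) with hT'
  have hTd : ∀ x ∈ Set.Icc a b, HasDerivAt T (T' x) x := by
    intro x hx
    have h1 : HasDerivAt (fun x : ℝ => k * (x - m)) k x := by
      simpa using ((hasDerivAt_id x).sub_const m).const_mul k
    have h2 := (Real.hasDerivAt_tan (hcos x hx).ne').comp x h1
    have h3 := h2.const_mul k
    refine h3.congr_deriv ?_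
    rw [hT']
    simp only
    rw [Real.tan_eq_sin_div_cos]
    have := (hcos x hx).ne'
    have h5 := Real.sin_sq_add_cos_sq (k * (x - m))
    field_simp
    nlinarith
  have hTc : ContinuousOn T (Set.Icc a b) := fun x hx => (hTd x hx).continuousAt.continuousWithinAt
  have hT'c : ContinuousOn T' (Set.Icc a b) := by
    have : ContinuousOn (fun x => k ^ 2 + T x ^ 2) (Set.Icc a b) := by fun_prop
    refine this.congr fun x _ => ?_
    simp only [hT, hT']
    ring
  have hTac : AbsolutelyContinuousOnInterval T a b := by
    obtain ⟨C, hC⟩ := isCompact_Icc.exists_bound_of_continuousOn hT'c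
    refine LipschitzOnWith.absolutelyContinuousOnInterval (K := C.toNNReal) ?_
    rw [Set.uIcc_of_le hab]
    refine (convex_Icc a b).lipschitzOnWith_of_nnnorm_hasDerivWithin_le
      (fun x hx => (hTd x hx).hasDerivWithinAt) fun x hx => ?_
    rw [← NNReal.coe_le_coe]
    exact (hC x hx).trans (Real.le_coe_toNNReal C)
  have hgc : ContinuousOn g (Set.uIcc a b) := hg.continuousOn
  have hTc' : ContinuousOn T (Set.uIcc a b) := by rwa [Set.uIcc_of_le hab]
  have hQ : AbsolutelyContinuousOnInterval (fun x => T x * (g x * g x)) a b :=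
    hTac.fun_mul (hg.fun_mul hg)
  have hQi := hQ.integral_deriv_eq_sub
  have hgi : IntervalIntegrable (fun x => g x ^ 2) volume a b := (hgc.pow 2).intervalIntegrable
  have hnn : 0 ≤ ∫ x in a..b,
      (deriv g x ^ 2 - k ^ 2 * g x ^ 2 + deriv (fun x => T x * (g x * g x)) x) := by
    refine intervalIntegral.integral_nonneg_of_ae_restrict hab ?_
    refine (ae_restrict_iff' measurableSet_Icc).2 ?_
    filter_upwards [hg.ae_differentiableAt] with x hx hxm
    have hgx := (hx (by rwa [Set.uIcc_of_le hab])).hasDerivAt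
    have h1 := (hTd x hxm).mul (hgx.mul hgx)
    have h2 : deriv (fun x => T x * (g x * g x)) x =
      T' x * (g x * g x) + T x * (deriv g x * g x + g x * deriv g x) := h1.deriv
    have h3 : (0:ℝ) ≤ (deriv g x + T x * g x) ^ 2 := sq_nonneg _
    have h4 : T' x = k ^ 2 + T x ^ 2 := by simp only [hT, hT']; ring
    simp only [Pi.zero_apply]
    rw [h2, h4]
    nlinarith
  rw [intervalIntegral.integral_add (hg2.sub (hgi.const_mul _)) hQ.intervalIntegrable_deriv,
    intervalIntegral.integral_sub hg2 (hgi.const_mul _),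
    intervalIntegral.integral_const_mul, hQi] at hnn
  simp only [hT] at hnn
  nlinarith

/-- Wirtinger's inequality with the Dirichlet constant `(π / (b - a))²` needs only one zero and
equal moduli at the end points: regarding `[a, b]` as a circle, it is the Dirichlet inequality
on the circle cut open at the zero. -/
theorem wirtinger_of_zero {g : ℝ → ℝ} {a b x₀ : ℝ} (hab : a < b)
    (hg : AbsolutelyContinuousOnInterval g a b)
    (hg2 : IntervalIntegrable (fun x => deriv g x ^ 2) volume a b)
    (hx₀ : x₀ ∈ Set.Icc a b) (h0 : g x₀ = 0) (hend : g a ^ 2 = g b ^ 2) :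
    (Real.pi / (b - a)) ^ 2 * ∫ x in a..b, g x ^ 2 ≤ ∫ x in a..b, deriv g x ^ 2 := by
  have hL : 0 < b - a := by linarith
  have key : ∀ k ∈ Set.Ioo 0 (Real.pi / (b - a)),
      k ^ 2 * (∫ x in a..b, g x ^ 2) ≤ ∫ x in a..b, deriv g x ^ 2 := by
    intro k hk
    have hkL : k * (b - a) < Real.pi := (lt_div_iff₀ hL).1 hk.2
    have hk0 := hk.1
    have hs1 : Set.uIcc a x₀ ⊆ Set.uIcc a b := by
      rw [Set.uIcc_of_le hx₀.1, Set.uIcc_of_le hab.le]; exact Set.Icc_subset_Icc_right hx₀.2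
    have hs2 : Set.uIcc x₀ b ⊆ Set.uIcc a b := by
      rw [Set.uIcc_of_le hx₀.2, Set.uIcc_of_le hab.le]; exact Set.Icc_subset_Icc_left hx₀.1
    -- The tangent centred half a period before, respectively after, the zero takes the same
    -- value at `a` and at `b`, so that the boundary terms cancel.
    have h1 := tan_boundary_le_integral (k := k) (m := x₀ - (b - a) / 2) hx₀.1
      (hg.mono hs1) (hg2.mono_set hs1) (by
        intro x hx; rw [abs_lt]; constructor <;> nlinarith [hx.1, hx.2, hx₀.1, hx₀.2])
    have h2 := tan_boundary_le_integral (k := k) (m := x₀ + (b - a) / 2) hx₀.2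
      (hg.mono hs2) (hg2.mono_set hs2) (by
        intro x hx; rw [abs_lt]; constructor <;> nlinarith [hx.1, hx.2, hx₀.1, hx₀.2])
    have hgi : IntervalIntegrable (fun x => g x ^ 2) volume a b :=
      (hg.continuousOn.pow 2).intervalIntegrable
    rw [← intervalIntegral.integral_add_adjacent_intervals (hg2.mono_set hs1) (hg2.mono_set hs2),
      ← intervalIntegral.integral_add_adjacent_intervals (hgi.mono_set hs1) (hgi.mono_set hs2)]
    have e : b - (x₀ + (b - a) / 2) = a - (x₀ - (b - a) / 2) := by ring
    rw [h0] at h1 h2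
    rw [e, ← hend] at h2
    nlinarith
  have hlim : Filter.Tendsto (fun k : ℝ => k ^ 2 * ∫ x in a..b, g x ^ 2)
      (nhdsWithin (Real.pi / (b - a)) (Set.Iio (Real.pi / (b - a))))
      (nhds ((Real.pi / (b - a)) ^ 2 * ∫ x in a..b, g x ^ 2)) :=
    Filter.Tendsto.mono_left (Continuous.tendsto (by fun_prop) _) nhdsWithin_le_nhds
  refine le_of_tendsto hlim ?_
  filter_upwards [Ioo_mem_nhdsLT (show (0:ℝ) < Real.pi / (b - a) by positivity)] with k hk
  exact key k hk

/-- **Wirtinger's inequality** for `2π`-periodic functions of mean zero. -/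
theorem wirtinger_periodic {g g' : ℝ → ℝ} (hg : ∀ x, HasDerivAt g (g' x) x)
    (hg' : Continuous g') (hper : Function.Periodic g (2 * Real.pi))
    (h0 : ∫ x in (0 : ℝ)..(2 * Real.pi), g x = 0) :
    ∫ x in (0 : ℝ)..(2 * Real.pi), g x ^ 2 ≤ ∫ x in (0 : ℝ)..(2 * Real.pi), g' x ^ 2 := by
  have hpi := Real.pi_pos
  have hgc : Continuous g := continuous_iff_continuousAt.2 fun x => (hg x).continuousAt
  have hper' : Function.Periodic g' (2 * Real.pi) := by
    intro x
    have h1 := (hg (x + 2 * Real.pi)).comp_add_const x (2 * Real.pi)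
    have h2 : (fun x => g (x + 2 * Real.pi)) = g := funext hper
    rw [h2] at h1
    exact h1.unique (hg x)
  -- A point where `g` takes the same value as half a period later.
  obtain ⟨x₀, hx₀⟩ : ∃ x₀, g x₀ = g (x₀ + Real.pi) := by
    have hc : Continuous fun x => g x - g (x + Real.pi) := by fun_prop
    have hs : g Real.pi - g (Real.pi + Real.pi) = -(g 0 - g (0 + Real.pi)) := by
      have := hper 0
      rw [zero_add] at this
      rw [← two_mul, this, zero_add]; ring
    rcases le_total 0 (g 0 - g (0 + Real.pi)) with h | h
    · obtain ⟨x, -, hx⟩ := intermediate_value_Icc' hpi.le hc.continuousOn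
        (show (0:ℝ) ∈ Set.Icc _ _ from ⟨by simp only [hs]; linarith, h⟩)
      exact ⟨x, sub_eq_zero.1 hx⟩
    · obtain ⟨x, -, hx⟩ := intermediate_value_Icc hpi.le hc.continuousOn
        (show (0:ℝ) ∈ Set.Icc _ _ from ⟨h, by simp only [hs]; linarith⟩)
      exact ⟨x, sub_eq_zero.1 hx⟩
  set c := g x₀ with hc
  have hd : ∀ x, HasDerivAt (fun x => g x - c) (g' x) x := fun x => (hg x).sub_const c
  have hderiv : deriv (fun x => g x - c) = g' := funext fun x => (hd x).deriv
  have hac : ∀ a b : ℝ, AbsolutelyContinuousOnInterval (fun x => g x - c) a b := by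
    intro a b
    refine ContDiffOn.absolutelyContinuousOnInterval (ContDiff.contDiffOn ?_)
    rw [contDiff_one_iff_deriv, hderiv]
    exact ⟨fun x => (hd x).differentiableAt, hg'⟩
  have hint : ∀ a b : ℝ, IntervalIntegrable (fun x => g' x ^ 2) volume a b := fun a b =>
    (hg'.pow 2).intervalIntegrable _ _
  have half : ∀ y, g y = c → g (y + Real.pi) = c →
      ∫ x in y..(y + Real.pi), (g x - c) ^ 2 ≤ ∫ x in y..(y + Real.pi), g' x ^ 2 := by
    intro y hy hy'
    have := wirtinger_of_zero (g := fun x => g x - c) (a := y) (b := y + Real.pi) (x₀ := y)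
      (by linarith) (hac _ _) (by rw [hderiv]; exact hint _ _) ⟨le_rfl, by linarith⟩
      (by simp [hy]) (by simp [hy, hy'])
    rw [hderiv] at this
    have e : Real.pi / (y + Real.pi - y) = 1 := by rw [add_sub_cancel_left, div_self hpi.ne']
    simpa [e] using this
  have e2 : x₀ + Real.pi + Real.pi = x₀ + 2 * Real.pi := by ring
  have h1 := half x₀ rfl hx₀.symm
  have h2 := half (x₀ + Real.pi) hx₀.symm (by rw [e2, hper x₀])
  have hi : ∀ a b : ℝ, IntervalIntegrable (fun x => (g x - c) ^ 2) volume a b := fun a b =>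
    Continuous.intervalIntegrable (by fun_prop) _ _
  have h3 := add_le_add h1 h2
  rw [intervalIntegral.integral_add_adjacent_intervals (hi _ _) (hi _ _),
    intervalIntegral.integral_add_adjacent_intervals (hint _ _) (hint _ _), e2] at h3
  have p1 : Function.Periodic (fun x => (g x - c) ^ 2) (2 * Real.pi) := fun x => by
    simp only [hper x]
  have p2 : Function.Periodic (fun x => g' x ^ 2) (2 * Real.pi) := fun x => by
    simp only [hper' x]
  rw [p1.intervalIntegral_add_eq x₀ 0, p2.intervalIntegral_add_eq x₀ 0, zero_add] at h3
  refine le_trans ?_ h3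
  have e3 : ∫ x in (0 : ℝ)..(2 * Real.pi), (g x - c) ^ 2 =
      (∫ x in (0 : ℝ)..(2 * Real.pi), g x ^ 2) + 2 * Real.pi * c ^ 2 := by
    have : (fun x => (g x - c) ^ 2) = fun x => g x ^ 2 - (2 * c) * g x + c ^ 2 := by
      funext x; ring
    rw [this, intervalIntegral.integral_add (Continuous.intervalIntegrable (by fun_prop) _ _)
      (by simp), intervalIntegral.integral_sub (Continuous.intervalIntegrable (by fun_prop) _ _)
      (Continuous.intervalIntegrable (by fun_prop) _ _), intervalIntegral.integral_const_mul, h0]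
    simp
  rw [e3]
  have : 0 ≤ 2 * Real.pi * c ^ 2 := by positivity
  linarith

/-! ### The heat flow on trigonometric polynomials -/

/-- The `k`-th space derivative at time `t` of the solution of the heat equation `f_t = f_xx` on
the circle that starts from the trigonometric polynomial `Re ∑ n ∈ S, c n * exp (i n x)`. -/
def heatTrig (S : Finset ℤ) (c : ℤ → ℂ) (k : ℕ) (t x : ℝ) : ℝ :=
  (∑ n ∈ S, c n * (Complex.I * n) ^ k * Complex.exp (-(n : ℂ) ^ 2 * t + Complex.I * n * x)).re

section Heat

variable (S : Finset ℤ) (c : ℤ → ℂ)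

theorem heatTrig_continuous (k : ℕ) :
    Continuous fun p : ℝ × ℝ => heatTrig S c k p.1 p.2 := by
  unfold heatTrig
  fun_prop

theorem heatTrig_hasDerivAt_space (k : ℕ) (t x : ℝ) :
    HasDerivAt (heatTrig S c k t) (heatTrig S c (k + 1) t x) x := by
  have h : HasDerivAt (fun x : ℝ => ∑ n ∈ S, c n * (Complex.I * n) ^ k *
      Complex.exp (-(n : ℂ) ^ 2 * t + Complex.I * n * x))
      (∑ n ∈ S, c n * (Complex.I * n) ^ (k + 1) *
        Complex.exp (-(n : ℂ) ^ 2 * t + Complex.I * n * x)) x := by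
    refine HasDerivAt.fun_sum fun n _ => ?_
    have h1 : HasDerivAt (fun x : ℝ => -(n : ℂ) ^ 2 * t + Complex.I * n * x)
        (Complex.I * n) x := by
      simpa using ((Complex.ofRealCLM.hasDerivAt (x := x)).const_mul (Complex.I * n)).const_add
        (-(n : ℂ) ^ 2 * t)
    refine (h1.cexp.const_mul _).congr_deriv ?_
    ring
  exact Complex.reCLM.hasFDerivAt.comp_hasDerivAt x h

theorem heatTrig_hasDerivAt_time (k : ℕ) (t x : ℝ) :
    HasDerivAt (fun t => heatTrig S c k t x) (heatTrig S c (k + 2) t x) t := by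
  have h : HasDerivAt (fun t : ℝ => ∑ n ∈ S, c n * (Complex.I * n) ^ k *
      Complex.exp (-(n : ℂ) ^ 2 * t + Complex.I * n * x))
      (∑ n ∈ S, c n * (Complex.I * n) ^ (k + 2) *
        Complex.exp (-(n : ℂ) ^ 2 * t + Complex.I * n * x)) t := by
    refine HasDerivAt.fun_sum fun n _ => ?_
    have h1 : HasDerivAt (fun t : ℝ => -(n : ℂ) ^ 2 * t + Complex.I * n * x)
        (-(n : ℂ) ^ 2) t := by
      simpa using ((Complex.ofRealCLM.hasDerivAt (x := t)).const_mul (-(n : ℂ) ^ 2)).add_const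
        (Complex.I * n * x)
    refine (h1.cexp.const_mul _).congr_deriv ?_
    rw [pow_add, mul_pow Complex.I _ 2, Complex.I_sq]
    ring
  exact Complex.reCLM.hasFDerivAt.comp_hasDerivAt t h

theorem heatTrig_periodic (k : ℕ) (t : ℝ) :
    Function.Periodic (heatTrig S c k t) (2 * Real.pi) := by
  intro x
  unfold heatTrig
  congr 1
  refine Finset.sum_congr rfl fun n _ => ?_
  have : -(n : ℂ) ^ 2 * t + Complex.I * n * ((x + 2 * Real.pi : ℝ) : ℂ) =
      -(n : ℂ) ^ 2 * t + Complex.I * n * x + n * (2 * Real.pi * Complex.I) := by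
    push_cast; ring
  rw [this, Complex.exp_add, Complex.exp_int_mul_two_pi_mul_I, mul_one]

theorem heatTrig_bound (k : ℕ) : ∃ B, ∀ t ≥ 0, ∀ x, |heatTrig S c k t x| ≤ B := by
  refine ⟨∑ n ∈ S, ‖c n * (Complex.I * n) ^ k‖, fun t ht x => ?_⟩
  refine (Complex.abs_re_le_norm _).trans ((norm_sum_le _ _).trans ?_)
  refine Finset.sum_le_sum fun n _ => ?_
  rw [norm_mul]
  refine mul_le_of_le_one_right (norm_nonneg _) ?_
  rw [Complex.norm_exp, Real.exp_le_one_iff]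
  have : (-(n : ℂ) ^ 2 * t + Complex.I * n * x).re = -((n : ℝ) ^ 2 * t) := by
    simp [Complex.add_re, Complex.mul_re, pow_two]
  rw [this]
  have : 0 ≤ (n : ℝ) ^ 2 * t := by positivity
  linarith

/-- The zeroth Fourier coefficient, that is, the mean value of the trigonometric polynomial. -/
def trigMean : ℝ := (∑ n ∈ S, if n = 0 then c n else 0).re

theorem heatTrig_tendsto (k : ℕ) (x : ℝ) :
    Filter.Tendsto (fun t => heatTrig S c k t x) Filter.atTop
      (nhds (if k = 0 then trigMean S c else 0)) := by
  have h : Filter.Tendsto (fun t : ℝ => ∑ n ∈ S, c n * (Complex.I * n) ^ k *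
      Complex.exp (-(n : ℂ) ^ 2 * t + Complex.I * n * x)) Filter.atTop
      (nhds (∑ n ∈ S, if n = 0 then c n * (Complex.I * n) ^ k else 0)) := by
    refine tendsto_finsetSum _ fun n _ => ?_
    by_cases hn : n = 0
    · subst hn; simp
    rw [if_neg hn, tendsto_zero_iff_norm_tendsto_zero]
    have e : ∀ t : ℝ, ‖c n * (Complex.I * n) ^ k *
        Complex.exp (-(n : ℂ) ^ 2 * t + Complex.I * n * x)‖ =
        ‖c n * (Complex.I * n) ^ k‖ * Real.exp (-((n : ℝ) ^ 2 * t)) := by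
      intro t
      rw [norm_mul, Complex.norm_exp]
      congr 2
      simp [Complex.add_re, Complex.mul_re, pow_two]
    simp_rw [e]
    have hn2 : 0 < (n : ℝ) ^ 2 := by positivity
    have := (Real.tendsto_exp_neg_atTop_nhds_zero.comp
      (Filter.tendsto_id.const_mul_atTop hn2)).const_mul ‖c n * (Complex.I * n) ^ k‖
    simpa using this
  have h2 := (Complex.continuous_re.tendsto _).comp h
  have e : (∑ n ∈ S, if n = 0 then c n * (Complex.I * n) ^ k else 0).re =
      if k = 0 then trigMean S c else 0 := by
    by_cases hk : k = 0
    · simp only [hk, pow_zero, mul_one, if_true, trigMean]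
    · rw [if_neg hk, Finset.sum_eq_zero, Complex.zero_re]
      intro n _
      split_ifs with hn
      · simp [hn, hk]
      · rfl
  rw [e] at h2
  exact h2

theorem integral_heatTrig :
    ∫ x in (0 : ℝ)..(2 * Real.pi), heatTrig S c 0 0 x = 2 * Real.pi * trigMean S c := by
  have h : ∫ x in (0 : ℝ)..(2 * Real.pi), ∑ n ∈ S, c n * (Complex.I * n) ^ 0 *
      Complex.exp (-(n : ℂ) ^ 2 * ((0 : ℝ) : ℂ) + Complex.I * n * x) =
      2 * Real.pi * ∑ n ∈ S, if n = 0 then c n else 0 := by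
    rw [intervalIntegral.integral_finsetSum
      fun n _ => Continuous.intervalIntegrable (by fun_prop) _ _, Finset.mul_sum]
    refine Finset.sum_congr rfl fun n _ => ?_
    simp only [pow_zero, mul_one, Complex.ofReal_zero, mul_zero, zero_add]
    rw [intervalIntegral.integral_const_mul]
    by_cases hn : n = 0
    · subst hn; simp; ring
    · have hne : Complex.I * n ≠ 0 := by simp [hn]
      rw [integral_exp_mul_complex hne, if_neg hn]
      have : Complex.I * n * ((2 * Real.pi : ℝ) : ℂ) = n * (2 * Real.pi * Complex.I) := by
        push_cast; ring
      rw [this, Complex.exp_int_mul_two_pi_mul_I]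
      simp
  have h2 := congrArg Complex.re h
  have h4 := Complex.reCLM.intervalIntegral_comp_comm (μ := volume) (a := 0) (b := 2 * Real.pi)
    (f := fun x : ℝ => ∑ n ∈ S, c n * (Complex.I * n) ^ 0 *
      Complex.exp (-(n : ℂ) ^ 2 * ((0 : ℝ) : ℂ) + Complex.I * n * x))
      (Continuous.intervalIntegrable (by fun_prop) _ _)
  simp only [Complex.reCLM_apply] at h4
  unfold heatTrig trigMean
  rw [h4, h2, show (2 * Real.pi : ℂ) = ((2 * Real.pi : ℝ) : ℂ) by push_cast; rfl,
    Complex.re_ofReal_mul]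

/-- Minimum principle for the heat flow. -/
theorem heatTrig_ge {δ : ℝ} (h0 : ∀ x, δ ≤ heatTrig S c 0 0 x) {t : ℝ} (ht : 0 ≤ t) (x : ℝ) :
    δ ≤ heatTrig S c 0 t x := by
  have hpi := Real.pi_pos
  refine le_of_forall_pos_le_add fun η hη => ?_
  -- With `ε t` added, the minimum over `[0, t] × [0, 2π]` can only sit at time `0`.
  obtain ⟨ε, hε, hεt⟩ : ∃ ε > 0, ε * t ≤ η :=
    ⟨η / (t + 1), by positivity, by rw [div_mul_eq_mul_div, div_le_iff₀ (by positivity)]; nlinarith⟩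
  set K : Set (ℝ × ℝ) := Set.Icc 0 t ×ˢ Set.Icc 0 (2 * Real.pi)
  have hK : IsCompact K := isCompact_Icc.prod isCompact_Icc
  have hKne : K.Nonempty := ⟨(0, 0), ⟨le_rfl, ht⟩, ⟨le_rfl, by positivity⟩⟩
  have hcont : Continuous fun p : ℝ × ℝ => heatTrig S c 0 p.1 p.2 + ε * p.1 := by
    have := heatTrig_continuous S c 0
    fun_prop
  obtain ⟨⟨t₀, x₀⟩, hmem, hmin⟩ := hK.exists_isMinOn hKne hcont.continuousOn
  have hmin' : ∀ s ∈ Set.Icc 0 t, ∀ y,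
      heatTrig S c 0 t₀ x₀ + ε * t₀ ≤ heatTrig S c 0 s y + ε * s := by
    intro s hs y
    obtain ⟨z, hz, hzy⟩ := (heatTrig_periodic S c 0 s).exists_mem_Ico₀ (by positivity) y
    rw [hzy]
    exact isMinOn_iff.1 hmin (s, z) ⟨hs, hz.1, hz.2.le⟩
  have hle : δ ≤ heatTrig S c 0 t₀ x₀ + ε * t₀ := by
    rcases hmem.1.1.eq_or_lt with h | h
    · simp only at h
      rw [← h]
      simpa using h0 x₀
    · exfalso
      simp only at h
      have hspace : 0 ≤ heatTrig S c 2 t₀ x₀ := by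
        by_contra! hneg
        have hd1 : deriv (heatTrig S c 0 t₀) = heatTrig S c 1 t₀ :=
          funext fun y => (heatTrig_hasDerivAt_space S c 0 t₀ y).deriv
        have hd2 : deriv (heatTrig S c 1 t₀) = heatTrig S c 2 t₀ :=
          funext fun y => (heatTrig_hasDerivAt_space S c 1 t₀ y).deriv
        have hmn : IsLocalMin (heatTrig S c 0 t₀) x₀ :=
          Filter.Eventually.of_forall fun y => by
            have := hmin' t₀ hmem.1 y
            linarith
        have hmx := isLocalMax_of_deriv_deriv_neg (f := heatTrig S c 0 t₀) (x₀ := x₀)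
          (by rw [hd1, hd2]; exact hneg) hmn.deriv_eq_zero
          (heatTrig_hasDerivAt_space S c 0 t₀ x₀).continuousAt
        have hev : heatTrig S c 0 t₀ =ᶠ[nhds x₀] fun _ => heatTrig S c 0 t₀ x₀ := by
          filter_upwards [hmn, hmx] with y h1 h2 using le_antisymm h2 h1
        have h5 := hev.deriv.deriv_eq
        rw [hd1, hd2] at h5
        simp at h5
        exact hneg.ne h5
      have htime : heatTrig S c 2 t₀ x₀ + ε ≤ 0 := by
        have hd : HasDerivAt (fun s => heatTrig S c 0 s x₀ + ε * s)
            (heatTrig S c 2 t₀ x₀ + ε) t₀ := by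
          exact ((heatTrig_hasDerivAt_time S c 0 t₀ x₀).add
            ((hasDerivAt_id t₀).const_mul ε)).congr_deriv (by simp)
        by_contra! hpos
        have hsl := (hasDerivAt_iff_tendsto_slope.1 hd).eventually_const_lt hpos
        have hsl' : ∀ᶠ s in nhdsWithin t₀ (Set.Iio t₀),
            0 < slope (fun s => heatTrig S c 0 s x₀ + ε * s) t₀ s :=
          hsl.filter_mono (nhdsWithin_mono _ fun s hs => ne_of_lt hs)
        obtain ⟨s, hs1, hs2⟩ := (hsl'.and (Ioo_mem_nhdsLT h)).exists
        rw [slope_def_field] at hs1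
        have h6 := hmin' s ⟨hs2.1.le, hs2.2.le.trans hmem.1.2⟩ x₀
        have h7 : s - t₀ < 0 := by linarith [hs2.2]
        exact absurd hs1 (not_lt.2 (div_nonpos_of_nonneg_of_nonpos (by linarith) h7.le))
      linarith
  have := hmin' t ⟨ht, le_rfl⟩ x
  linarith

end Heat

section Energy

variable (S : Finset ℤ) (c : ℤ → ℂ) (q : ℝ)

/-- The density `u² + (q - 2) u'²` of the Sobolev energy in terms of `f = u ^ q` and `f₁ = f'`. -/
def energyDensity (q f f₁ : ℝ) : ℝ := f ^ (2 / q) * (1 + (q - 2) / q ^ 2 * (f₁ / f) ^ 2)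

/-- The time derivative of `energyDensity` under the heat equation, where `f₁`, `f₂`, `f₃` stand for
the space derivatives of `f`. -/
def energyRate (q f f₁ f₂ f₃ : ℝ) : ℝ :=
  f ^ (2 / q) * (2 / q * (f₂ / f) * (1 + (q - 2) / q ^ 2 * (f₁ / f) ^ 2) +
    2 * (q - 2) / q ^ 2 * (f₁ / f) * (f₃ / f - f₁ / f * (f₂ / f)))

theorem energyDensity_hasDerivAt (hq : q ≠ 0) {F F₁ : ℝ → ℝ} {f₂ f₃ t : ℝ} (hF : 0 < F t)
    (h : HasDerivAt F f₂ t) (h₁ : HasDerivAt F₁ f₃ t) :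
    HasDerivAt (fun t => energyDensity q (F t) (F₁ t)) (energyRate q (F t) (F₁ t) f₂ f₃) t := by
  unfold energyDensity energyRate
  have hp : HasDerivAt (fun t => F t ^ (2 / q)) (F t ^ (2 / q) * (2 / q * (f₂ / F t))) t := by
    refine (h.rpow_const (Or.inl hF.ne')).congr_deriv ?_
    rw [Real.rpow_sub_one hF.ne']
    ring
  have hF' := hF.ne'
  have hL : HasDerivAt (fun t => (F₁ t / F t) ^ 2)
      (2 * (F₁ t / F t) * ((f₃ * F t - F₁ t * f₂) / F t ^ 2)) t := by
    simpa using (h₁.fun_div h hF').fun_pow 2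
  refine (hp.fun_mul ((hL.const_mul ((q - 2) / q ^ 2)).const_add 1)).congr_deriv ?_
  field_simp

/-- The dissipation identity: up to an exact derivative, the rate of the energy is
`-2 (q - 2) (u''² - u'² + (q - 1) / 3 * u'⁴ / u²)`, where `u = f ^ (1 / q)`. -/
theorem energyRate_integral_nonpos {F F₁ F₂ F₃ : ℝ → ℝ} (hq : 2 < q)
    (hF : ∀ x, 0 < F x) (h : ∀ x, HasDerivAt F (F₁ x) x) (h₁ : ∀ x, HasDerivAt F₁ (F₂ x) x)
    (h₂ : ∀ x, HasDerivAt F₂ (F₃ x) x) (h₃ : Continuous F₃)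
    (hp : Function.Periodic F (2 * Real.pi)) (hp₁ : Function.Periodic F₁ (2 * Real.pi))
    (hp₂ : Function.Periodic F₂ (2 * Real.pi)) :
    ∫ x in (0 : ℝ)..(2 * Real.pi), energyRate q (F x) (F₁ x) (F₂ x) (F₃ x) ≤ 0 := by
  have hq0 : q ≠ 0 := by positivity
  have c0 : Continuous F := continuous_iff_continuousAt.2 fun x => (h x).continuousAt
  have c1 : Continuous F₁ := continuous_iff_continuousAt.2 fun x => (h₁ x).continuousAt
  have c2 : Continuous F₂ := continuous_iff_continuousAt.2 fun x => (h₂ x).continuousAt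
  have hF' : ∀ x, F x ≠ 0 := fun x => (hF x).ne'
  have cp : ∀ a : ℝ, Continuous fun x => F x ^ a := fun a =>
    c0.rpow_const fun x => Or.inl (hF' x)
  -- `u`, `u'` and `u''`
  set u : ℝ → ℝ := fun x => F x ^ (1 / q) with hu
  set v : ℝ → ℝ := fun x => u x * (1 / q * (F₁ x / F x)) with hv
  set w : ℝ → ℝ := fun x =>
    u x * (1 / q * (F₂ x / F x - (F₁ x / F x) ^ 2) + (1 / q * (F₁ x / F x)) ^ 2) with hw
  have cu : Continuous u := cp _
  have cv : Continuous v := by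
    simp only [hv]
    exact cu.mul (continuous_const.mul (c1.div c0 hF'))
  have cw : Continuous w := by
    simp only [hw]
    exact cu.mul ((continuous_const.mul ((c2.div c0 hF').sub ((c1.div c0 hF').pow 2))).add
      ((continuous_const.mul (c1.div c0 hF')).pow 2))
  have hud : ∀ x, HasDerivAt u (v x) x := by
    intro x
    refine ((h x).rpow_const (Or.inl (hF' x))).congr_deriv ?_
    simp only [hv, hu]
    rw [Real.rpow_sub_one (hF' x)]
    ring
  have hvd : ∀ x, HasDerivAt v (w x) x := by
    intro x
    refine ((hud x).fun_mul (((h₁ x).fun_div (h x) (hF' x)).const_mul (1 / q))).congr_deriv ?_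
    simp only [hv, hw]
    have := hF' x
    field_simp
    ring
  have hup : Function.Periodic u (2 * Real.pi) := fun x => by simp only [hu, hp x]
  have hvp : Function.Periodic v (2 * Real.pi) := fun x => by simp only [hv, hup x, hp x, hp₁ x]
  have hu2 : ∀ x, F x ^ (2 / q) = u x ^ 2 := fun x => by
    rw [hu, ← Real.rpow_mul_natCast (hF x).le]; congr 1; push_cast; ring
  have hv0 : ∫ x in (0 : ℝ)..(2 * Real.pi), v x = 0 := by
    rw [intervalIntegral.integral_eq_sub_of_hasDerivAt (fun x _ => hud x)
      (cv.intervalIntegrable _ _), sub_eq_zero]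
    simpa using hup 0
  have hW := wirtinger_periodic hvd cw hvp hv0
  -- The exact derivative.
  set Z : ℝ → ℝ := fun x => u x ^ 2 * (2 / q * (F₁ x / F x) +
    2 * (q - 2) / q ^ 2 * (F₁ x / F x) * (F₂ x / F x) -
    2 / 3 * (q - 2) * (q - 1) / q ^ 3 * (F₁ x / F x) ^ 3) with hZ
  set R : ℝ → ℝ := fun x => energyRate q (F x) (F₁ x) (F₂ x) (F₃ x) with hR
  have cR : Continuous R := by
    simp only [hR, energyRate]
    have d1 := c1.div c0 hF'
    have d2 := c2.div c0 hF'
    have d3 := h₃.div c0 hF'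
    exact (cp _).mul (((continuous_const.mul d2).mul (continuous_const.add
      (continuous_const.mul (d1.pow 2)))).add ((continuous_const.mul d1).mul (d3.sub (d1.mul d2))))
  set N : ℝ → ℝ := fun x => u x ^ 2 * (F₁ x / F x) ^ 4 with hN
  have cN : Continuous N := (cu.pow 2).mul ((c1.div c0 hF').pow 4)
  have hZd : ∀ x, HasDerivAt Z (R x + 2 * (q - 2) * (w x ^ 2 - v x ^ 2) +
      2 * (q - 2) * ((q - 1) / (3 * q ^ 4)) * N x) x := by
    intro x
    have d1 := (h₁ x).fun_div (h x) (hF' x)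
    have d2 := (h₂ x).fun_div (h x) (hF' x)
    have d3 : HasDerivAt (fun y => (F₁ y / F y) ^ 3)
        (3 * (F₁ x / F x) ^ 2 * ((F₂ x * F x - F₁ x * F₁ x) / F x ^ 2)) x := by
      simpa using d1.fun_pow 3
    refine (((hud x).fun_pow 2).fun_mul (((d1.const_mul (2 / q)).fun_add
      ((d1.const_mul (2 * (q - 2) / q ^ 2)).fun_mul d2)).fun_sub
      (d3.const_mul (2 / 3 * (q - 2) * (q - 1) / q ^ 3)))).congr_deriv ?_
    simp only [hR, hN, hv, hw, energyRate, hu2]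
    have := hF' x
    field_simp
    ring
  have hZp : Function.Periodic Z (2 * Real.pi) := fun x => by
    simp only [hZ, hup x, hp x, hp₁ x, hp₂ x]
  have cD : Continuous fun x => R x + 2 * (q - 2) * (w x ^ 2 - v x ^ 2) +
      2 * (q - 2) * ((q - 1) / (3 * q ^ 4)) * N x := by fun_prop
  have hint := intervalIntegral.integral_eq_sub_of_hasDerivAt (a := 0) (b := 2 * Real.pi)
    (fun x _ => hZd x) (cD.intervalIntegrable _ _)
  have hZ0 : Z (2 * Real.pi) = Z 0 := by simpa using hZp 0
  have i : ∀ {f : ℝ → ℝ}, Continuous f → IntervalIntegrable f volume 0 (2 * Real.pi) :=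
    fun hf => hf.intervalIntegrable _ _
  rw [hZ0, sub_self, intervalIntegral.integral_add (i (by fun_prop)) (i (by fun_prop)),
    intervalIntegral.integral_add (i cR) (i (by fun_prop)), intervalIntegral.integral_const_mul,
    intervalIntegral.integral_const_mul,
    intervalIntegral.integral_sub (i (by fun_prop)) (i (by fun_prop))] at hint
  have hNn : 0 ≤ ∫ x in (0 : ℝ)..(2 * Real.pi), N x :=
    intervalIntegral.integral_nonneg (by positivity) fun x _ => by positivity
  have k1 : 0 ≤ 2 * (q - 2) := by linarith
  have k2 : 0 ≤ 2 * (q - 2) * ((q - 1) / (3 * q ^ 4)) :=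
    mul_nonneg k1 (div_nonneg (by linarith) (by positivity))
  have m1 := mul_nonneg k1 (sub_nonneg.2 hW)
  have m2 := mul_nonneg k2 hNn
  linarith

/-- The Sobolev inequality for the functions whose `q`-th power is a positive trigonometric
polynomial: the energy decreases along the heat flow, towards its value at the mean. -/
theorem sobolev_heatTrig (hq : 2 < q) (hpos : ∀ x, 0 < heatTrig S c 0 0 x) :
    (2 * Real.pi) ^ (1 - 2 / q) * (∫ x in (0 : ℝ)..(2 * Real.pi), heatTrig S c 0 0 x) ^ (2 / q) ≤
      ∫ x in (0 : ℝ)..(2 * Real.pi), energyDensity q (heatTrig S c 0 0 x) (heatTrig S c 1 0 x) := by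
  have hpi := Real.pi_pos
  have hcont : ∀ k t, Continuous (heatTrig S c k t) := fun k t =>
    continuous_iff_continuousAt.2 fun x => (heatTrig_hasDerivAt_space S c k t x).continuousAt
  obtain ⟨δ, hδ, hge⟩ : ∃ δ > 0, ∀ x, δ ≤ heatTrig S c 0 0 x := by
    obtain ⟨x₀, -, hx₀⟩ := isCompact_Icc.exists_isMinOn (s := Set.Icc 0 (2 * Real.pi))
      (Set.nonempty_Icc.2 (by positivity)) (hcont 0 0).continuousOn
    refine ⟨heatTrig S c 0 0 x₀, hpos x₀, fun x => ?_⟩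
    obtain ⟨z, hz, hzx⟩ := (heatTrig_periodic S c 0 0).exists_mem_Ico₀ (by positivity) x
    have hmin := isMinOn_iff.1 hx₀ z ⟨hz.1, hz.2.le⟩
    exact hmin.trans_eq hzx.symm
  have hge' : ∀ t, 0 ≤ t → ∀ x, δ ≤ heatTrig S c 0 t x := fun t ht x => heatTrig_ge S c hge ht x
  -- Truncating at `δ` does not change anything for `t ≥ 0`, and makes the energy density
  -- continuous everywhere.
  set M : ℝ → ℝ → ℝ := fun t x => max (heatTrig S c 0 t x) δ with hM
  have hMeq : ∀ t, 0 ≤ t → ∀ x, M t x = heatTrig S c 0 t x := fun t ht x => max_eq_left (hge' t ht x)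
  have hMpos : ∀ t x, 0 < M t x := fun t x => lt_max_of_lt_right hδ
  have cM : Continuous fun p : ℝ × ℝ => M p.1 p.2 := (heatTrig_continuous S c 0).max continuous_const
  have cMp : Continuous fun p : ℝ × ℝ => M p.1 p.2 ^ (2 / q) :=
    cM.rpow_const fun p => Or.inl (hMpos _ _).ne'
  have cdiv : ∀ k, Continuous fun p : ℝ × ℝ => heatTrig S c k p.1 p.2 / M p.1 p.2 := fun k =>
    (heatTrig_continuous S c k).div cM fun p => (hMpos _ _).ne'
  have cE : Continuous fun p : ℝ × ℝ => energyDensity q (M p.1 p.2) (heatTrig S c 1 p.1 p.2) :=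
    cMp.mul (continuous_const.add (continuous_const.mul ((cdiv 1).pow 2)))
  have cR : Continuous fun p : ℝ × ℝ => energyRate q (M p.1 p.2) (heatTrig S c 1 p.1 p.2)
      (heatTrig S c 2 p.1 p.2) (heatTrig S c 3 p.1 p.2) :=
    cMp.mul (((continuous_const.mul (cdiv 2)).mul
      (continuous_const.add (continuous_const.mul ((cdiv 1).pow 2)))).add
      ((continuous_const.mul (cdiv 1)).mul ((cdiv 3).sub ((cdiv 1).mul (cdiv 2)))))
  set En : ℝ → ℝ := fun t =>
    ∫ x in (0 : ℝ)..(2 * Real.pi), energyDensity q (M t x) (heatTrig S c 1 t x) with hEn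
  have cEn : Continuous En :=
    intervalIntegral.continuous_parametric_intervalIntegral_of_continuous' cE _ _
  have hder : ∀ t, 0 < t → HasDerivAt En (∫ x in (0 : ℝ)..(2 * Real.pi),
      energyRate q (M t x) (heatTrig S c 1 t x) (heatTrig S c 2 t x) (heatTrig S c 3 t x)) t := by
    intro t ht
    obtain ⟨B, hB⟩ := (isCompact_Icc.prod isCompact_Icc :
      IsCompact (Set.Icc (0:ℝ) (t + 1) ×ˢ Set.Icc (0:ℝ) (2 * Real.pi))).exists_bound_of_continuousOn
        cR.continuousOn
    refine (intervalIntegral.hasDerivAt_integral_of_dominated_loc_of_deriv_le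
      (F := fun t x => energyDensity q (M t x) (heatTrig S c 1 t x))
      (F' := fun t x => energyRate q (M t x) (heatTrig S c 1 t x) (heatTrig S c 2 t x)
        (heatTrig S c 3 t x)) (s := Set.Ioo 0 (t + 1)) (bound := fun _ => B)
      (Ioo_mem_nhds ht (by linarith)) ?_ ?_ ?_ ?_ (by simp) ?_).2
    · exact Filter.Eventually.of_forall fun t =>
        (cE.comp (Continuous.prodMk continuous_const continuous_id)).aestronglyMeasurable
    · exact (cE.comp (Continuous.prodMk continuous_const continuous_id)).intervalIntegrable _ _
    · exact (cR.comp (Continuous.prodMk continuous_const continuous_id)).aestronglyMeasurable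
    · refine Filter.Eventually.of_forall fun x hx s hs => ?_
      rw [Set.uIoc_of_le (by positivity)] at hx
      exact hB (s, x) ⟨⟨hs.1.le, hs.2.le⟩, ⟨hx.1.le, hx.2⟩⟩
    · refine Filter.Eventually.of_forall fun x _ s hs => ?_
      have h1 := energyDensity_hasDerivAt q (by positivity) (F := fun t => heatTrig S c 0 t x)
        (F₁ := fun t => heatTrig S c 1 t x) (t := s) (hδ.trans_le (hge' s hs.1.le x))
        (heatTrig_hasDerivAt_time S c 0 s x) (heatTrig_hasDerivAt_time S c 1 s x)
      rw [hMeq s hs.1.le x]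
      refine h1.congr_of_eventuallyEq ?_
      filter_upwards [lt_mem_nhds hs.1] with y hy
      rw [hMeq y hy.le x]
  have hanti : AntitoneOn En (Set.Ici 0) := by
    refine antitoneOn_of_deriv_nonpos (convex_Ici 0) cEn.continuousOn ?_ ?_
    · rw [interior_Ici]
      exact fun t ht => (hder t ht).differentiableAt.differentiableWithinAt
    · rw [interior_Ici]
      intro t ht
      rw [(hder t ht).deriv]
      have ht0 : 0 ≤ t := le_of_lt ht
      simp_rw [hMeq t ht0]
      exact energyRate_integral_nonpos q hq (fun x => hδ.trans_le (hge' t ht0 x))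
        (heatTrig_hasDerivAt_space S c 0 t) (heatTrig_hasDerivAt_space S c 1 t)
        (heatTrig_hasDerivAt_space S c 2 t) (hcont 3 t) (heatTrig_periodic S c 0 t)
        (heatTrig_periodic S c 1 t) (heatTrig_periodic S c 2 t)
  set m := trigMean S c
  have hlim0 : ∀ x, Filter.Tendsto (fun t => heatTrig S c 0 t x) Filter.atTop (nhds m) := fun x => by
    simpa using heatTrig_tendsto S c 0 x
  have hlim1 : ∀ x, Filter.Tendsto (fun t => heatTrig S c 1 t x) Filter.atTop (nhds 0) := fun x => by
    simpa using heatTrig_tendsto S c 1 x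
  have hm : δ ≤ m := ge_of_tendsto (hlim0 0) (by
    filter_upwards [Filter.eventually_ge_atTop 0] with t ht using hge' t ht 0)
  have hm0 : 0 < m := hδ.trans_le hm
  have hlim : Filter.Tendsto En Filter.atTop (nhds (∫ x in (0 : ℝ)..(2 * Real.pi), m ^ (2 / q))) := by
    obtain ⟨B₀, hB₀⟩ := heatTrig_bound S c 0
    obtain ⟨B₁, hB₁⟩ := heatTrig_bound S c 1
    refine intervalIntegral.tendsto_integral_filter_of_dominated_convergence
      (fun _ => B₀ ^ (2 / q) * (1 + (q - 2) / q ^ 2 * (B₁ / δ) ^ 2)) ?_ ?_ (by simp) ?_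
    · exact Filter.Eventually.of_forall fun t =>
        (cE.comp (Continuous.prodMk continuous_const continuous_id)).aestronglyMeasurable
    · filter_upwards [Filter.eventually_ge_atTop 0] with t ht
      refine Filter.Eventually.of_forall fun x _ => ?_
      rw [hMeq t ht x, energyDensity]
      have hf := hδ.trans_le (hge' t ht x)
      have hq2 : 0 ≤ (q - 2) / q ^ 2 := div_nonneg (by linarith) (by positivity)
      have e1 : (heatTrig S c 1 t x / heatTrig S c 0 t x) ^ 2 ≤ (B₁ / δ) ^ 2 := by
        rw [← sq_abs, abs_div, abs_of_pos hf]
        have hb := hB₁ t ht x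
        have hg := hge' t ht x
        gcongr
        exact (abs_nonneg _).trans hb
      have e2 : heatTrig S c 0 t x ^ (2 / q) ≤ B₀ ^ (2 / q) :=
        Real.rpow_le_rpow hf.le ((le_abs_self _).trans (hB₀ t ht x)) (by positivity)
      have e3 : 0 ≤ heatTrig S c 0 t x ^ (2 / q) := by positivity
      rw [Real.norm_of_nonneg (by positivity)]
      exact mul_le_mul e2 (by nlinarith) (by positivity) (e3.trans e2)
    · refine Filter.Eventually.of_forall fun x _ => ?_
      have hev : (fun t => energyDensity q (heatTrig S c 0 t x) (heatTrig S c 1 t x))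
          =ᶠ[Filter.atTop] fun t => energyDensity q (M t x) (heatTrig S c 1 t x) := by
        filter_upwards [Filter.eventually_ge_atTop 0] with t ht
        rw [hMeq t ht x]
      refine Filter.Tendsto.congr' hev ?_
      have t1 : Filter.Tendsto (fun t => heatTrig S c 0 t x ^ (2 / q)) Filter.atTop
          (nhds (m ^ (2 / q))) := (hlim0 x).rpow_const (Or.inl hm0.ne')
      have t2 := ((((hlim1 x).div (hlim0 x) hm0.ne').pow 2).const_mul ((q - 2) / q ^ 2)).const_add 1
      have t3 := t1.mul t2
      simpa [energyDensity] using t3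
  have hfin : ∫ x in (0 : ℝ)..(2 * Real.pi), m ^ (2 / q) ≤ En 0 := by
    refine le_of_tendsto hlim ?_
    filter_upwards [Filter.eventually_ge_atTop 0] with t ht
    exact hanti Set.self_mem_Ici ht ht
  have hE0 : En 0 = ∫ x in (0 : ℝ)..(2 * Real.pi),
      energyDensity q (heatTrig S c 0 0 x) (heatTrig S c 1 0 x) := by
    simp only [hEn, hMeq 0 le_rfl]
  rw [← hE0, integral_heatTrig]
  refine le_of_eq_of_le ?_ hfin
  rw [intervalIntegral.integral_const, sub_zero, smul_eq_mul,
    Real.mul_rpow (by positivity) hm0.le, ← mul_assoc, ← Real.rpow_add (by positivity)]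
  simp

end Energy

/-! ### Approximation by trigonometric polynomials -/

/-- The Fourier series of a square integrable function of mean zero converges in mean square. -/
theorem exists_trig_approx {h : ℝ → ℂ} (hL2 : MemLp h 2 (volume.restrict (Set.Ioc 0 (2 * Real.pi))))
    (h0 : ∫ x in (0 : ℝ)..(2 * Real.pi), h x = 0) {ε : ℝ} (hε : 0 < ε) :
    ∃ (S : Finset ℤ) (c : ℤ → ℂ), c 0 = 0 ∧
      ∫ x in (0 : ℝ)..(2 * Real.pi), ‖h x - ∑ n ∈ S, c n * Complex.exp (Complex.I * n * x)‖ ^ 2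
        < ε := by
  have hpi := Real.pi_pos
  set T : ℝ := 2 * Real.pi with hT
  have hT0 : 0 < T := by positivity
  have : Fact (0 < T) := ⟨hT0⟩
  have hL2' : MemLp h 2 (volume.restrict (Set.Ioc 0 (0 + T))) := by rwa [zero_add]
  have hH := hL2'.memLp_liftIoc.haarAddCircle
  set H : AddCircle T → ℂ := AddCircle.liftIoc T 0 h
  set F : Lp ℂ 2 (@AddCircle.haarAddCircle T _) := hH.toLp
  set c : ℤ → ℂ := fourierCoeff F
  have hc0 : c 0 = 0 := by
    have h1 : c 0 = fourierCoeff H 0 := by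
      simp only [c]
      rw [fourierCoeff_congr_ae hH.coeFn_toLp]
    rw [h1, fourierCoeff_eq_intervalIntegral H 0 0]
    have h2 : ∫ x in (0 : ℝ)..(0 + T), fourier (-0) (x : AddCircle T) • H x = 0 := by
      rw [← h0, zero_add]
      refine intervalIntegral.integral_congr_ae (Filter.Eventually.of_forall fun x hx => ?_)
      rw [Set.uIoc_of_le hT0.le] at hx
      rw [neg_zero, fourier_zero, one_smul]
      exact AddCircle.liftIoc_coe_apply (by rwa [zero_add])
    rw [h2, smul_zero]
  have hsum : Filter.Tendsto (fun S : Finset ℤ => ∑ n ∈ S, c n • fourierLp 2 n) Filter.atTop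
      (nhds F) := hasSum_fourier_series_L2 F
  have hnorm := ((tendsto_const_nhds (x := F)).sub hsum).norm.pow 2
  rw [sub_self, norm_zero, zero_pow two_ne_zero] at hnorm
  obtain ⟨S, hS⟩ := (hnorm.eventually_lt_const (show 0 < ε / T by positivity)).exists
  refine ⟨S, c, hc0, ?_⟩
  set D := F - ∑ n ∈ S, c n • fourierLp 2 n with hD
  have hnD : ‖D‖ ^ 2 = ∫ t, ‖D t‖ ^ 2 ∂AddCircle.haarAddCircle := by
    have h3 := congr_arg RCLike.re (@L2.inner_def (AddCircle T) ℂ ℂ _ _ _ _ _ D D)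
    rw [← integral_re (L2.integrable_inner D D)] at h3
    simpa only [← norm_sq_eq_re_inner] using h3
  have hDae : D =ᵐ[AddCircle.haarAddCircle] fun t => H t - ∑ n ∈ S, c n * fourier n t := by
    have h4 : ∀ n : ℤ, (c n • fourierLp 2 n : Lp ℂ 2 (@AddCircle.haarAddCircle T _))
        =ᵐ[AddCircle.haarAddCircle] fun t => c n * fourier n t := fun n => by
      filter_upwards [Lp.coeFn_smul (c n) (fourierLp (T := T) 2 n),
        coeFn_fourierLp (T := T) 2 n] with t ht1 ht2
      rw [ht1, Pi.smul_apply, ht2, smul_eq_mul]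
    have h5 : ∀ᵐ t ∂(@AddCircle.haarAddCircle T _), ∀ n : ℤ,
        (c n • fourierLp 2 n : Lp ℂ 2 (@AddCircle.haarAddCircle T _)) t = c n * fourier n t :=
      ae_all_iff.2 h4
    filter_upwards [Lp.coeFn_sub F (∑ n ∈ S, c n • fourierLp 2 n), hH.coeFn_toLp,
      Lp.coeFn_fun_finsetSum S fun n => c n • fourierLp (T := T) 2 n, h5] with t e1 e2 e3 e4
    rw [e1, Pi.sub_apply, e2, e3]
    simp_rw [e4]
  have hI : ∫ x in (0 : ℝ)..T, ‖h x - ∑ n ∈ S, c n * Complex.exp (Complex.I * n * x)‖ ^ 2 =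
      T * ‖D‖ ^ 2 := by
    have h6 : ∫ t, ‖D t‖ ^ 2 ∂AddCircle.haarAddCircle =
        ∫ t, ‖H t - ∑ n ∈ S, c n * fourier n t‖ ^ 2 ∂AddCircle.haarAddCircle := by
      refine integral_congr_ae ?_
      filter_upwards [hDae] with t ht
      rw [ht]
    rw [hnD, h6, AddCircle.integral_haarAddCircle, ← AddCircle.intervalIntegral_preimage T 0,
      smul_eq_mul, mul_inv_cancel_left₀ hT0.ne', zero_add]
    refine intervalIntegral.integral_congr_ae (Filter.Eventually.of_forall fun x hx => ?_)
    rw [Set.uIoc_of_le hT0.le] at hx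
    have h7 : H x = h x := AddCircle.liftIoc_coe_apply (by rwa [zero_add])
    have h8 : ∀ n : ℤ, fourier n (x : AddCircle T) = Complex.exp (Complex.I * n * x) := by
      intro n
      rw [fourier_coe_apply]
      congr 1
      have : (Real.pi : ℂ) ≠ 0 := by exact_mod_cast hpi.ne'
      rw [hT]
      push_cast
      field_simp
    simp only [h7, h8]
  rw [hI]
  calc T * ‖D‖ ^ 2 < T * (ε / T) := by gcongr
    _ = ε := by field_simp

/-- Approximation of an absolutely continuous function on the circle with square integrable
derivative, uniformly and, for the derivative, in mean square. -/
theorem exists_heatTrig_approx {f : ℝ → ℝ} (hf : AbsolutelyContinuousOnInterval f 0 (2 * Real.pi))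
    (hper : f 0 = f (2 * Real.pi))
    (hf2 : IntervalIntegrable (fun x => deriv f x ^ 2) volume 0 (2 * Real.pi))
    {ε : ℝ} (hε : 0 < ε) :
    ∃ (S : Finset ℤ) (c : ℤ → ℂ),
      (∀ x ∈ Set.Icc 0 (2 * Real.pi), |heatTrig S c 0 0 x - f x| ≤ ε) ∧
      ∫ x in (0 : ℝ)..(2 * Real.pi), (heatTrig S c 1 0 x - deriv f x) ^ 2 ≤ ε := by
  have hpi := Real.pi_pos
  have hpi2 : (0 : ℝ) ≤ 2 * Real.pi := by positivity
  have hdi := hf.intervalIntegrable_deriv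
  have hL2 : MemLp (fun x => ((deriv f x : ℝ) : ℂ)) 2 (volume.restrict (Set.Ioc 0 (2 * Real.pi))) := by
    have : MemLp (deriv f) 2 (volume.restrict (Set.Ioc 0 (2 * Real.pi))) := by
      rw [memLp_two_iff_integrable_sq (measurable_deriv f).aestronglyMeasurable]
      exact (intervalIntegrable_iff_integrableOn_Ioc_of_le hpi2).1 hf2
    exact this.ofReal
  have h0 : ∫ x in (0 : ℝ)..(2 * Real.pi), ((deriv f x : ℝ) : ℂ) = 0 := by
    rw [intervalIntegral.integral_ofReal, hf.integral_deriv_eq_sub, hper, sub_self,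
      Complex.ofReal_zero]
  obtain ⟨η, hη, hη1, hη2⟩ : ∃ η > 0, η ^ 2 ≤ ε ∧ η * (2 * Real.pi + 1) ≤ ε := by
    refine ⟨min 1 ε / (2 * Real.pi + 1), by positivity, ?_, ?_⟩
    · have h1 : min 1 ε / (2 * Real.pi + 1) ≤ min 1 ε :=
        div_le_self (by positivity) (by linarith)
      have h2 : 0 ≤ min 1 ε / (2 * Real.pi + 1) := by positivity
      have h3 := min_le_left 1 ε
      have h4 := min_le_right 1 ε
      nlinarith
    · rw [div_mul_cancel₀ _ (by positivity)]
      exact min_le_right _ _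
  obtain ⟨S, c, hc0, hS⟩ := exists_trig_approx hL2 h0 (show 0 < η ^ 2 by positivity)
  -- Integrate the approximation of the derivative term by term, and fix the constant at `0`.
  set d : ℤ → ℂ := fun n => c n / (Complex.I * n) with hd
  set K : ℂ := (f 0 : ℂ) - ∑ n ∈ S.erase 0, d n with hK
  refine ⟨insert 0 (S.erase 0), fun n => if n = 0 then K else d n, ?_⟩
  set P := heatTrig (insert 0 (S.erase 0)) fun n => if n = 0 then K else d n with hP
  have hne : ∀ n ∈ S.erase 0, n ≠ 0 := fun n hn => Finset.ne_of_mem_erase hn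
  have hP0 : P 0 0 0 = f 0 := by
    simp only [hP, heatTrig]
    rw [Finset.sum_insert (Finset.notMem_erase 0 S)]
    have : ∑ n ∈ S.erase 0, (if n = 0 then K else d n) * (Complex.I * n) ^ 0 *
        Complex.exp (-(n : ℂ) ^ 2 * ((0 : ℝ) : ℂ) + Complex.I * n * ((0 : ℝ) : ℂ)) =
        ∑ n ∈ S.erase 0, d n := by
      refine Finset.sum_congr rfl fun n hn => ?_
      simp [hne n hn]
    rw [this]
    simp [hK]
  have hP1 : ∀ x, P 1 0 x = (∑ n ∈ S, c n * Complex.exp (Complex.I * n * x)).re := by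
    intro x
    simp only [hP, heatTrig]
    rw [Finset.sum_insert (Finset.notMem_erase 0 S)]
    have e1 : ∑ n ∈ S, c n * Complex.exp (Complex.I * n * x) =
        ∑ n ∈ S.erase 0, c n * Complex.exp (Complex.I * n * x) := by
      symm
      refine Finset.sum_subset (Finset.erase_subset _ _) fun n hn hn' => ?_
      have : n = 0 := by
        by_contra h
        exact hn' (Finset.mem_erase.2 ⟨h, hn⟩)
      rw [this, hc0, zero_mul]
    rw [e1]
    congr 1
    simp only [Int.cast_zero, mul_zero, pow_one, zero_mul, zero_add]
    refine Finset.sum_congr rfl fun n hn => ?_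
    have hn0 : (n : ℂ) ≠ 0 := by exact_mod_cast hne n hn
    rw [if_neg (hne n hn), hd]
    simp only [Complex.ofReal_zero, mul_zero, zero_add]
    rw [div_mul_cancel₀ _ (mul_ne_zero Complex.I_ne_zero hn0)]
  have cP : ∀ k, Continuous (P k 0) := fun k =>
    continuous_iff_continuousAt.2 fun x => (heatTrig_hasDerivAt_space _ _ k 0 x).continuousAt
  have hPi : IntervalIntegrable (P 1 0) volume 0 (2 * Real.pi) := (cP 1).intervalIntegrable _ _
  have hsqi : IntervalIntegrable (fun x => (P 1 0 x - deriv f x) ^ 2) volume 0 (2 * Real.pi) := by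
    have h1 : IntervalIntegrable (fun x => P 1 0 x ^ 2 - 2 * (P 1 0 x * deriv f x) +
        deriv f x ^ 2) volume 0 (2 * Real.pi) :=
      ((((cP 1).pow 2).intervalIntegrable _ _).sub
        ((hdi.continuousOn_mul (cP 1).continuousOn).const_mul 2)).add hf2
    exact h1.congr fun x _ => by ring
  have hsq : ∫ x in (0 : ℝ)..(2 * Real.pi), (P 1 0 x - deriv f x) ^ 2 ≤ η ^ 2 := by
    refine le_trans ?_ hS.le
    refine intervalIntegral.integral_mono_on hpi2 hsqi ?_ fun x _ => ?_
    · rw [intervalIntegrable_iff_integrableOn_Ioc_of_le hpi2]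
      refine MemLp.integrable_norm_pow (p := 2) ?_ two_ne_zero
      refine hL2.sub ?_
      refine MemLp.of_bound (Continuous.aestronglyMeasurable (by fun_prop)) (∑ n ∈ S, ‖c n‖)
        (Filter.Eventually.of_forall fun x => (norm_sum_le _ _).trans ?_)
      refine Finset.sum_le_sum fun n _ => ?_
      have : Complex.I * n * x = ((n * x : ℝ) : ℂ) * Complex.I := by push_cast; ring
      rw [norm_mul, this, Complex.norm_exp_ofReal_mul_I, mul_one]
    · rw [hP1, ← sq_abs, abs_sub_comm]
      gcongr
      refine le_of_eq_of_le ?_ (Complex.abs_re_le_norm _)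
      simp
  refine ⟨fun x hx => ?_, hsq.trans hη1⟩
  have hsub : Set.uIcc 0 x ⊆ Set.uIcc 0 (2 * Real.pi) := by
    rw [Set.uIcc_of_le hx.1, Set.uIcc_of_le hpi2]; exact Set.Icc_subset_Icc_right hx.2
  have e1 : P 0 0 x - f x = ∫ y in (0 : ℝ)..x, (P 1 0 y - deriv f y) := by
    rw [intervalIntegral.integral_sub ((cP 1).intervalIntegrable _ _) (hdi.mono_set hsub),
      (hf.mono hsub).integral_deriv_eq_sub,
      intervalIntegral.integral_eq_sub_of_hasDerivAt
        (fun y _ => heatTrig_hasDerivAt_space _ _ 0 0 y) ((cP 1).intervalIntegrable _ _)]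
    change P 0 0 x - f x = P 0 0 x - P 0 0 0 - (f x - f 0)
    rw [hP0]
    ring
  have hbi : IntervalIntegrable (fun y => (η + η⁻¹ * (P 1 0 y - deriv f y) ^ 2) / 2) volume 0
      (2 * Real.pi) := ((by simp : IntervalIntegrable (fun _ => η) volume 0 (2 * Real.pi)).add
        (hsqi.const_mul _)).div_const 2
  have habs : IntervalIntegrable (fun y => |P 1 0 y - deriv f y|) volume 0 (2 * Real.pi) :=
    (hPi.sub hdi).abs
  rw [e1]
  calc |∫ y in (0 : ℝ)..x, (P 1 0 y - deriv f y)|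
      ≤ ∫ y in (0 : ℝ)..x, |P 1 0 y - deriv f y| :=
        intervalIntegral.abs_integral_le_integral_abs hx.1
    _ ≤ ∫ y in (0 : ℝ)..(2 * Real.pi), |P 1 0 y - deriv f y| :=
        intervalIntegral.integral_mono_interval le_rfl hx.1 hx.2
          (Filter.Eventually.of_forall fun y => abs_nonneg _) habs
    _ ≤ ∫ y in (0 : ℝ)..(2 * Real.pi), (η + η⁻¹ * (P 1 0 y - deriv f y) ^ 2) / 2 := by
        refine intervalIntegral.integral_mono_on hpi2 habs hbi fun y _ => ?_
        have h1 : 0 ≤ η⁻¹ * (η - |P 1 0 y - deriv f y|) ^ 2 := by positivity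
        have h2 : η⁻¹ * (η - |P 1 0 y - deriv f y|) ^ 2 =
            η - 2 * |P 1 0 y - deriv f y| + η⁻¹ * (P 1 0 y - deriv f y) ^ 2 := by
          rw [sub_sq, sq_abs]
          field_simp
        linarith
    _ = (2 * Real.pi * η + η⁻¹ * ∫ y in (0 : ℝ)..(2 * Real.pi), (P 1 0 y - deriv f y) ^ 2) / 2 := by
        rw [intervalIntegral.integral_div, intervalIntegral.integral_add (by simp)
          (hsqi.const_mul _), intervalIntegral.integral_const_mul]
        simp
    _ ≤ (2 * Real.pi * η + η⁻¹ * η ^ 2) / 2 := by gcongr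
    _ = η * (2 * Real.pi + 1) / 2 := by field_simp
    _ ≤ ε := by nlinarith

/-! ### The Sobolev inequality on the circle -/

/-- Stability of the energy density under approximation of `f = w ^ q` by `p` with relative error
`θ`, and of `f' = f₁` by `p₁`. -/
theorem energyDensity_le {q θ w w₁ f₁ p p₁ C : ℝ} (hq : 2 < q) (hθ : θ ∈ Set.Ioo (0 : ℝ) 1)
    (hw : 0 < w) (hf₁ : f₁ * w = q * w ^ q * w₁) (h1 : (1 - θ) * w ^ q ≤ p)
    (h2 : p ≤ (1 + θ) * w ^ q) (hC : w ^ 2 / (w ^ q) ^ 2 ≤ C) :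
    energyDensity q p p₁ ≤ (1 + θ) * w ^ 2 + (q - 2) * ((1 + θ) / (1 - θ) ^ 2) *
      ((1 + θ) * w₁ ^ 2 + (1 + 1 / θ) / q ^ 2 * C * (p₁ - f₁) ^ 2) := by
  obtain ⟨hθ0, hθ1⟩ := hθ
  have hq0 : 0 < q := by linarith
  set f := w ^ q with hf
  have hf0 : 0 < f := Real.rpow_pos_of_pos hw q
  have hθ' : 0 < 1 - θ := by linarith
  have hp0 : 0 < p := (mul_pos hθ' hf0).trans_le h1
  have hpow : p ^ (2 / q) ≤ (1 + θ) * w ^ 2 := by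
    calc p ^ (2 / q) ≤ ((1 + θ) * f) ^ (2 / q) :=
          Real.rpow_le_rpow hp0.le h2 (by positivity)
      _ = (1 + θ) ^ (2 / q) * w ^ 2 := by
          rw [Real.mul_rpow (by linarith) hf0.le, hf, ← Real.rpow_mul hw.le,
            mul_div_cancel₀ _ hq0.ne', Real.rpow_two]
      _ ≤ (1 + θ) ^ (1 : ℝ) * w ^ 2 := by
          gcongr
          · linarith
          · rw [div_le_one hq0]; exact hq.le
      _ = (1 + θ) * w ^ 2 := by rw [Real.rpow_one]
  have hyoung : p₁ ^ 2 ≤ (1 + θ) * f₁ ^ 2 + (1 + 1 / θ) * (p₁ - f₁) ^ 2 := by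
    have h3 : 0 ≤ (θ * f₁ - (p₁ - f₁)) ^ 2 / θ := by positivity
    have h4 : (θ * f₁ - (p₁ - f₁)) ^ 2 / θ =
        (1 + θ) * f₁ ^ 2 + (1 + 1 / θ) * (p₁ - f₁) ^ 2 - p₁ ^ 2 := by
      field_simp
      ring
    linarith
  have hquot : (p₁ / p) ^ 2 ≤
      ((1 + θ) * f₁ ^ 2 + (1 + 1 / θ) * (p₁ - f₁) ^ 2) / ((1 - θ) * f) ^ 2 := by
    rw [div_pow]
    gcongr
  have hfw : f₁ ^ 2 / f ^ 2 * w ^ 2 = q ^ 2 * w₁ ^ 2 := by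
    rw [div_mul_eq_mul_div, ← mul_pow, hf₁]
    field_simp
  have hmain : p ^ (2 / q) * (p₁ / p) ^ 2 ≤ (1 + θ) / (1 - θ) ^ 2 *
      ((1 + θ) * (q ^ 2 * w₁ ^ 2) + (1 + 1 / θ) * (C * (p₁ - f₁) ^ 2)) := by
    calc p ^ (2 / q) * (p₁ / p) ^ 2 ≤ (1 + θ) * w ^ 2 *
          (((1 + θ) * f₁ ^ 2 + (1 + 1 / θ) * (p₁ - f₁) ^ 2) / ((1 - θ) * f) ^ 2) := by
          gcongr
      _ = (1 + θ) / (1 - θ) ^ 2 * ((1 + θ) * (f₁ ^ 2 / f ^ 2 * w ^ 2) +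
          (1 + 1 / θ) * (w ^ 2 / f ^ 2 * (p₁ - f₁) ^ 2)) := by
          field_simp
      _ ≤ _ := by
          rw [hfw]
          gcongr
  unfold energyDensity
  have hk : 0 ≤ (q - 2) / q ^ 2 := div_nonneg (by linarith) (by positivity)
  calc p ^ (2 / q) * (1 + (q - 2) / q ^ 2 * (p₁ / p) ^ 2)
      = p ^ (2 / q) + (q - 2) / q ^ 2 * (p ^ (2 / q) * (p₁ / p) ^ 2) := by ring
    _ ≤ (1 + θ) * w ^ 2 + (q - 2) / q ^ 2 * ((1 + θ) / (1 - θ) ^ 2 *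
      ((1 + θ) * (q ^ 2 * w₁ ^ 2) + (1 + 1 / θ) * (C * (p₁ - f₁) ^ 2))) := by gcongr
    _ = _ := by
      field_simp

/-- The sharp Sobolev inequality for functions bounded away from `0`: `w ^ q` is approximated by
trigonometric polynomials with relative error `θ`, and `θ` tends to `0`. -/
theorem sobolev_of_pos {q ε : ℝ} (hq : 2 < q) (hε : 0 < ε) {w : ℝ → ℝ}
    (hw : AbsolutelyContinuousOnInterval w 0 (2 * Real.pi)) (hper : w 0 = w (2 * Real.pi))
    (hw2 : IntervalIntegrable (fun x => deriv w x ^ 2) volume 0 (2 * Real.pi))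
    (hwε : ∀ x ∈ Set.Icc 0 (2 * Real.pi), ε ≤ w x) :
    (2 * Real.pi) ^ (1 - 2 / q) * (∫ x in (0 : ℝ)..(2 * Real.pi), w x ^ q) ^ (2 / q) ≤
      (∫ x in (0 : ℝ)..(2 * Real.pi), w x ^ 2) +
        (q - 2) * ∫ x in (0 : ℝ)..(2 * Real.pi), deriv w x ^ 2 := by
  have hpi := Real.pi_pos
  have hpi2 : (0 : ℝ) ≤ 2 * Real.pi := by positivity
  have hq0 : 0 < q := by linarith
  have hu : Set.uIcc 0 (2 * Real.pi) = Set.Icc 0 (2 * Real.pi) := Set.uIcc_of_le hpi2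
  have hwc : ContinuousOn w (Set.Icc 0 (2 * Real.pi)) := hu ▸ hw.continuousOn
  obtain ⟨M, hM⟩ := isCompact_Icc.exists_bound_of_continuousOn hwc
  have hwM : ∀ x ∈ Set.Icc 0 (2 * Real.pi), w x ≤ M := fun x hx => (le_abs_self _).trans (hM x hx)
  have hwpos : ∀ x ∈ Set.Icc 0 (2 * Real.pi), 0 < w x := fun x hx => hε.trans_le (hwε x hx)
  set F : ℝ → ℝ := fun x => w x ^ q with hF
  have hFac : AbsolutelyContinuousOnInterval F 0 (2 * Real.pi) := by
    have hcd : ContDiffOn ℝ 1 (fun y : ℝ => y ^ q) (Set.Icc ε M) := fun y hy =>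
      (Real.contDiffAt_rpow_const_of_ne (hε.trans_le hy.1).ne').contDiffWithinAt
    obtain ⟨K, hK⟩ := hcd.exists_lipschitzOnWith one_ne_zero (convex_Icc _ _) isCompact_Icc
    exact hK.comp_absolutelyContinuousOnInterval hw fun x hx => ⟨hwε x (hu ▸ hx), hwM x (hu ▸ hx)⟩
  have hFd : ∀ᵐ x, x ∈ Set.Icc 0 (2 * Real.pi) → deriv F x = q * w x ^ (q - 1) * deriv w x := by
    filter_upwards [hw.ae_differentiableAt] with x hx hxm
    have := ((hx (hu ▸ hxm)).hasDerivAt.rpow_const (p := q) (Or.inl (hwpos x hxm).ne')).deriv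
    simp only [hF]
    rw [this]
    ring
  have hF2 : IntervalIntegrable (fun x => deriv F x ^ 2) volume 0 (2 * Real.pi) := by
    have hc : ContinuousOn (fun x => (q * w x ^ (q - 1)) ^ 2) (Set.uIcc 0 (2 * Real.pi)) := by
      rw [hu]
      exact (continuousOn_const.mul (hwc.rpow_const fun x hx => Or.inl (hwpos x hx).ne')).pow 2
    refine (hw2.continuousOn_mul hc).congr_ae ?_
    refine (ae_restrict_iff' measurableSet_uIoc).2 ?_
    filter_upwards [hFd] with x hx hxm
    rw [Set.uIoc_of_le hpi2] at hxm
    rw [hx ⟨hxm.1.le, hxm.2⟩]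
    ring
  have hFi : IntervalIntegrable F volume 0 (2 * Real.pi) := hFac.continuousOn.intervalIntegrable
  have hFε : ∀ x ∈ Set.Icc 0 (2 * Real.pi), ε ^ q ≤ F x := fun x hx =>
    Real.rpow_le_rpow hε.le (hwε x hx) hq0.le
  have hεq : 0 < ε ^ q := Real.rpow_pos_of_pos hε q
  set C : ℝ := M ^ 2 / (ε ^ q) ^ 2 with hC
  set A := ∫ x in (0 : ℝ)..(2 * Real.pi), w x ^ 2
  set B := ∫ x in (0 : ℝ)..(2 * Real.pi), deriv w x ^ 2
  set Q := ∫ x in (0 : ℝ)..(2 * Real.pi), F x with hQ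
  have hQ0 : 0 ≤ Q := intervalIntegral.integral_nonneg hpi2 fun x hx =>
    hεq.le.trans (hFε x hx)
  have key : ∀ θ ∈ Set.Ioo (0 : ℝ) 1, (2 * Real.pi) ^ (1 - 2 / q) * ((1 - θ) * Q) ^ (2 / q) ≤
      (1 + θ) * A + (q - 2) * ((1 + θ) / (1 - θ) ^ 2) *
        ((1 + θ) * B + (θ ^ 2 + θ) / q ^ 2 * C) := by
    intro θ hθ
    obtain ⟨S, c, hS, hS2⟩ := exists_heatTrig_approx hFac (by simp only [hF, hper]) hF2
      (show 0 < min (θ * ε ^ q) (θ ^ 2) from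
        lt_min (mul_pos hθ.1 hεq) (by have := hθ.1; positivity))
    have hclose : ∀ x ∈ Set.Icc 0 (2 * Real.pi), (1 - θ) * F x ≤ heatTrig S c 0 0 x ∧
        heatTrig S c 0 0 x ≤ (1 + θ) * F x := by
      intro x hx
      have h1 := abs_le.1 ((hS x hx).trans (min_le_left _ _))
      have h2 := mul_le_mul_of_nonneg_left (hFε x hx) hθ.1.le
      constructor <;> linarith
    have hpos : ∀ x, 0 < heatTrig S c 0 0 x := by
      intro x
      obtain ⟨z, hz, hzx⟩ := (heatTrig_periodic S c 0 0).exists_mem_Ico₀ (by positivity) x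
      rw [hzx]
      have hz' : z ∈ Set.Icc 0 (2 * Real.pi) := ⟨hz.1, hz.2.le⟩
      exact (mul_pos (by linarith [hθ.2]) (hεq.trans_le (hFε z hz'))).trans_le (hclose z hz').1
    have hcont : ∀ k, Continuous (heatTrig S c k 0) := fun k =>
      continuous_iff_continuousAt.2 fun x => (heatTrig_hasDerivAt_space S c k 0 x).continuousAt
    have hsob := sobolev_heatTrig S c q hq hpos
    have hlow : (1 - θ) * Q ≤ ∫ x in (0 : ℝ)..(2 * Real.pi), heatTrig S c 0 0 x := by
      rw [hQ, ← intervalIntegral.integral_const_mul]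
      exact intervalIntegral.integral_mono_on hpi2 (hFi.const_mul _)
        ((hcont 0).intervalIntegrable _ _) fun x hx => (hclose x hx).1
    have hEi : IntervalIntegrable (fun x => energyDensity q (heatTrig S c 0 0 x)
        (heatTrig S c 1 0 x)) volume 0 (2 * Real.pi) :=
      (((hcont 0).rpow_const fun x => Or.inl (hpos x).ne').mul (continuous_const.add
        (continuous_const.mul (((hcont 1).div (hcont 0) fun x => (hpos x).ne').pow 2)))
        ).intervalIntegrable _ _
    have hsqi : IntervalIntegrable (fun x => (heatTrig S c 1 0 x - deriv F x) ^ 2) volume 0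
        (2 * Real.pi) := by
      have h1 : IntervalIntegrable (fun x => heatTrig S c 1 0 x ^ 2 -
          2 * (heatTrig S c 1 0 x * deriv F x) + deriv F x ^ 2) volume 0 (2 * Real.pi) :=
        ((((hcont 1).pow 2).intervalIntegrable _ _).sub
          ((hFac.intervalIntegrable_deriv.continuousOn_mul (hcont 1).continuousOn).const_mul
            2)).add hF2
      exact h1.congr fun x _ => by ring
    have hwi : IntervalIntegrable (fun x => w x ^ 2) volume 0 (2 * Real.pi) :=
      (hw.continuousOn.pow 2).intervalIntegrable
    have hup : ∫ x in (0 : ℝ)..(2 * Real.pi), energyDensity q (heatTrig S c 0 0 x)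
        (heatTrig S c 1 0 x) ≤ ∫ x in (0 : ℝ)..(2 * Real.pi), ((1 + θ) * w x ^ 2 +
          (q - 2) * ((1 + θ) / (1 - θ) ^ 2) * ((1 + θ) * deriv w x ^ 2 +
          (1 + 1 / θ) / q ^ 2 * C * (heatTrig S c 1 0 x - deriv F x) ^ 2)) := by
      refine intervalIntegral.integral_mono_ae_restrict hpi2 hEi ((hwi.const_mul _).add
        (((hw2.const_mul _).add (hsqi.const_mul _)).const_mul _)) ?_
      refine (ae_restrict_iff' measurableSet_Icc).2 ?_
      filter_upwards [hFd] with x hx hxm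
      have hwx := hwpos x hxm
      refine energyDensity_le hq hθ hwx ?_ (hclose x hxm).1 (hclose x hxm).2 ?_
      · rw [hx hxm, Real.rpow_sub_one hwx.ne']
        field_simp
      · have h1 := hwM x hxm
        have h2 := hFε x hxm
        rw [hC]
        gcongr
    rw [intervalIntegral.integral_add (hwi.const_mul _)
      (((hw2.const_mul _).add (hsqi.const_mul _)).const_mul _),
      intervalIntegral.integral_const_mul, intervalIntegral.integral_const_mul,
      intervalIntegral.integral_add (hw2.const_mul _) (hsqi.const_mul _),
      intervalIntegral.integral_const_mul, intervalIntegral.integral_const_mul] at hup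
    have hθ0 := hθ.1
    have hθ1 : 0 < 1 - θ := by linarith [hθ.2]
    have hq2 : 0 ≤ q - 2 := by linarith
    calc (2 * Real.pi) ^ (1 - 2 / q) * ((1 - θ) * Q) ^ (2 / q)
        ≤ (2 * Real.pi) ^ (1 - 2 / q) *
          (∫ x in (0 : ℝ)..(2 * Real.pi), heatTrig S c 0 0 x) ^ (2 / q) := by gcongr
      _ ≤ _ := hsob
      _ ≤ _ := hup
      _ ≤ (1 + θ) * A + (q - 2) * ((1 + θ) / (1 - θ) ^ 2) *
          ((1 + θ) * B + (1 + 1 / θ) / q ^ 2 * C * θ ^ 2) := by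
          have := hS2.trans (min_le_right _ _)
          gcongr
      _ = _ := by
          congr 3
          field_simp
  have hl : Filter.Tendsto (fun θ : ℝ => (2 * Real.pi) ^ (1 - 2 / q) * ((1 - θ) * Q) ^ (2 / q))
      (nhdsWithin 0 (Set.Ioi 0)) (nhds ((2 * Real.pi) ^ (1 - 2 / q) * ((1 - 0) * Q) ^ (2 / q))) := by
    refine Filter.Tendsto.mono_left (Continuous.tendsto ?_ 0) nhdsWithin_le_nhds
    exact continuous_const.mul (Continuous.rpow_const (by fun_prop) fun _ => Or.inr (by positivity))
  have hr : Filter.Tendsto (fun θ : ℝ => (1 + θ) * A + (q - 2) * ((1 + θ) / (1 - θ) ^ 2) *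
        ((1 + θ) * B + (θ ^ 2 + θ) / q ^ 2 * C)) (nhdsWithin 0 (Set.Ioi 0))
      (nhds ((1 + 0) * A + (q - 2) * ((1 + 0) / (1 - 0) ^ 2) *
        ((1 + 0) * B + (0 ^ 2 + 0) / q ^ 2 * C))) := by
    refine Filter.Tendsto.mono_left (ContinuousAt.tendsto ?_) nhdsWithin_le_nhds
    have h1 : ContinuousAt (fun θ : ℝ => (1 + θ) / (1 - θ) ^ 2) 0 :=
      ContinuousAt.div (by fun_prop) (by fun_prop) (by simp)
    fun_prop
  have hfin := le_of_tendsto_of_tendsto hl hr (by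
    filter_upwards [Ioo_mem_nhdsGT (zero_lt_one (α := ℝ))] with θ hθ using key θ hθ)
  simpa using hfin

/-- The **sharp Sobolev inequality on the circle** (equality holds for constants). -/
theorem sobolev_circle {q : ℝ} (hq : 2 < q) {r : ℝ → ℝ}
    (hr : AbsolutelyContinuousOnInterval r 0 (2 * Real.pi)) (hper : r 0 = r (2 * Real.pi))
    (hr2 : IntervalIntegrable (fun x => deriv r x ^ 2) volume 0 (2 * Real.pi))
    (hr0 : ∀ x, 0 ≤ r x) :
    (2 * Real.pi) ^ (1 - 2 / q) * (∫ x in (0 : ℝ)..(2 * Real.pi), r x ^ q) ^ (2 / q) ≤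
      (∫ x in (0 : ℝ)..(2 * Real.pi), r x ^ 2) +
        (q - 2) * ∫ x in (0 : ℝ)..(2 * Real.pi), deriv r x ^ 2 := by
  have hpi2 : (0 : ℝ) ≤ 2 * Real.pi := by positivity
  have hq0 : 0 < q := by linarith
  have hri : IntervalIntegrable r volume 0 (2 * Real.pi) := hr.continuousOn.intervalIntegrable
  have hr2i : IntervalIntegrable (fun x => r x ^ 2) volume 0 (2 * Real.pi) :=
    (hr.continuousOn.pow 2).intervalIntegrable
  have hrq : ∀ ε : ℝ, IntervalIntegrable (fun x => (r x + ε) ^ q) volume 0 (2 * Real.pi) := fun ε =>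
    ((hr.continuousOn.add continuousOn_const).rpow_const fun x _ => Or.inr hq0.le).intervalIntegrable
  have key : ∀ ε > 0, (2 * Real.pi) ^ (1 - 2 / q) *
      (∫ x in (0 : ℝ)..(2 * Real.pi), r x ^ q) ^ (2 / q) ≤
      (∫ x in (0 : ℝ)..(2 * Real.pi), r x ^ 2) + 2 * ε * (∫ x in (0 : ℝ)..(2 * Real.pi), r x) +
        2 * Real.pi * ε ^ 2 + (q - 2) * ∫ x in (0 : ℝ)..(2 * Real.pi), deriv r x ^ 2 := by
    intro ε hε
    have hac : AbsolutelyContinuousOnInterval (fun x => r x + ε) 0 (2 * Real.pi) :=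
      hr.fun_add (LipschitzOnWith.absolutelyContinuousOnInterval
        (LipschitzWith.const ε).lipschitzOnWith)
    have hd : deriv (fun x => r x + ε) = deriv r := by
      funext x
      simp
    have h1 := sobolev_of_pos hq hε hac (by simp only [hper]) (by rwa [hd])
      fun x _ => by linarith [hr0 x]
    rw [hd] at h1
    have h2 : ∫ x in (0 : ℝ)..(2 * Real.pi), (r x + ε) ^ 2 =
        (∫ x in (0 : ℝ)..(2 * Real.pi), r x ^ 2) + 2 * ε * (∫ x in (0 : ℝ)..(2 * Real.pi), r x) +
        2 * Real.pi * ε ^ 2 := by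
      have : (fun x => (r x + ε) ^ 2) = fun x => r x ^ 2 + 2 * ε * r x + ε ^ 2 := by
        funext x; ring
      rw [this, intervalIntegral.integral_add (hr2i.add (hri.const_mul _)) (by simp),
        intervalIntegral.integral_add hr2i (hri.const_mul _), intervalIntegral.integral_const_mul]
      simp
    rw [h2] at h1
    refine le_trans ?_ h1
    have h3 : 0 ≤ ∫ x in (0 : ℝ)..(2 * Real.pi), r x ^ q :=
      intervalIntegral.integral_nonneg hpi2 fun x _ => Real.rpow_nonneg (hr0 x) q
    have h4 : ∫ x in (0 : ℝ)..(2 * Real.pi), r x ^ q ≤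
        ∫ x in (0 : ℝ)..(2 * Real.pi), (r x + ε) ^ q :=
      intervalIntegral.integral_mono_on hpi2 (by simpa using hrq 0) (hrq ε) fun x _ =>
        Real.rpow_le_rpow (hr0 x) (by linarith) hq0.le
    gcongr
  have hlim : Filter.Tendsto (fun ε : ℝ => (∫ x in (0 : ℝ)..(2 * Real.pi), r x ^ 2) +
      2 * ε * (∫ x in (0 : ℝ)..(2 * Real.pi), r x) +
        2 * Real.pi * ε ^ 2 + (q - 2) * ∫ x in (0 : ℝ)..(2 * Real.pi), deriv r x ^ 2)
      (nhdsWithin 0 (Set.Ioi 0)) (nhds ((∫ x in (0 : ℝ)..(2 * Real.pi), r x ^ 2) +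
      2 * 0 * (∫ x in (0 : ℝ)..(2 * Real.pi), r x) +
        2 * Real.pi * 0 ^ 2 + (q - 2) * ∫ x in (0 : ℝ)..(2 * Real.pi), deriv r x ^ 2)) :=
    Filter.Tendsto.mono_left (Continuous.tendsto (by fun_prop) 0) nhdsWithin_le_nhds
  have := ge_of_tendsto hlim (by filter_upwards [self_mem_nhdsWithin] with ε hε using key ε hε)
  simpa using this

/-! ### The polar problem -/

/-- Dividing the phase by `2 α` produces a function whose phase increases by `π` over a period, so
that it is antiperiodic and satisfies Wirtinger's inequality with the constant `1 / 4`. -/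
theorem half_flux_inequality {α : ℝ} (hα : α ≠ 0) {r p : ℝ → ℝ}
    (hr : AbsolutelyContinuousOnInterval r 0 (2 * Real.pi)) (hper : r 0 = r (2 * Real.pi))
    (hr2 : IntervalIntegrable (fun x => deriv r x ^ 2) volume 0 (2 * Real.pi))
    (hp : IntervalIntegrable p volume 0 (2 * Real.pi))
    (hp2 : IntervalIntegrable (fun x => r x ^ 2 * p x ^ 2) volume 0 (2 * Real.pi))
    (hpint : ∫ x in (0 : ℝ)..(2 * Real.pi), p x = 2 * Real.pi * α) :
    α ^ 2 * (∫ x in (0 : ℝ)..(2 * Real.pi), r x ^ 2) ≤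
      4 * α ^ 2 * (∫ x in (0 : ℝ)..(2 * Real.pi), deriv r x ^ 2) +
        ∫ x in (0 : ℝ)..(2 * Real.pi), r x ^ 2 * p x ^ 2 := by
  have hpi := Real.pi_pos
  have hpi2 : (0 : ℝ) < 2 * Real.pi := by positivity
  have hu : Set.uIcc 0 (2 * Real.pi) = Set.Icc 0 (2 * Real.pi) := Set.uIcc_of_le hpi2.le
  have hP : IntervalIntegrable (fun x => p x / (2 * α)) volume 0 (2 * Real.pi) := hp.div_const _
  set ψ : ℝ → ℝ := fun x => ∫ y in (0 : ℝ)..x, p y / (2 * α) with hψ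
  have hψac : AbsolutelyContinuousOnInterval ψ 0 (2 * Real.pi) :=
    hP.absolutelyContinuousOnInterval_intervalIntegral Set.left_mem_uIcc
  have hψ0 : ψ 0 = 0 := intervalIntegral.integral_same
  have hψ1 : ψ (2 * Real.pi) = Real.pi := by
    simp only [hψ]
    rw [intervalIntegral.integral_div, hpint]
    field_simp
  have hψd : ∀ᵐ x, x ∈ Set.uIcc 0 (2 * Real.pi) → HasDerivAt ψ (p x / (2 * α)) x := by
    filter_upwards [hP.ae_hasDerivAt_integral] with x hx hxm
    exact hx hxm 0 Set.left_mem_uIcc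
  set f : ℝ → ℝ := fun x => r x * Real.cos (ψ x) with hf
  set g : ℝ → ℝ := fun x => r x * Real.sin (ψ x) with hg
  have hfac : AbsolutelyContinuousOnInterval f 0 (2 * Real.pi) :=
    hr.fun_mul (Real.lipschitzWith_cos.comp_absolutelyContinuousOnInterval hψac)
  have hgac : AbsolutelyContinuousOnInterval g 0 (2 * Real.pi) :=
    hr.fun_mul (Real.lipschitzWith_sin.comp_absolutelyContinuousOnInterval hψac)
  have hsum : ∀ᵐ x, x ∈ Set.uIcc 0 (2 * Real.pi) →
      deriv f x ^ 2 + deriv g x ^ 2 = deriv r x ^ 2 + 1 / (4 * α ^ 2) * (r x ^ 2 * p x ^ 2) := by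
    filter_upwards [hr.ae_differentiableAt, hψd] with x h1 h2 hx
    have h3 : deriv f x = _ := ((h1 hx).hasDerivAt.mul (h2 hx).cos).deriv
    have h4 : deriv g x = _ := ((h1 hx).hasDerivAt.mul (h2 hx).sin).deriv
    rw [h3, h4]
    have h5 : ∀ a b s c k : ℝ, s ^ 2 + c ^ 2 = 1 →
        (a * c + b * (-s * k)) ^ 2 + (a * s + b * (c * k)) ^ 2 = a ^ 2 + b ^ 2 * k ^ 2 := by
      intro a b s c k h
      linear_combination (a ^ 2 + b ^ 2 * k ^ 2) * h
    rw [h5 _ _ _ _ _ (Real.sin_sq_add_cos_sq (ψ x))]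
    field_simp
    ring
  have hsi : IntervalIntegrable (fun x => deriv r x ^ 2 + 1 / (4 * α ^ 2) * (r x ^ 2 * p x ^ 2))
      volume 0 (2 * Real.pi) := hr2.add (hp2.const_mul _)
  have hae : ∀ {P : ℝ → Prop}, (∀ᵐ x, x ∈ Set.uIcc 0 (2 * Real.pi) → P x) →
      ∀ᵐ x ∂(volume.restrict (Set.uIoc 0 (2 * Real.pi))), P x := by
    intro P h
    refine (ae_restrict_iff' measurableSet_uIoc).2 ?_
    filter_upwards [h] with x hx hxm using hx (Set.uIoc_subset_uIcc hxm)
  have hf2 : IntervalIntegrable (fun x => deriv f x ^ 2) volume 0 (2 * Real.pi) := by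
    refine hsi.mono_fun' ((measurable_deriv f).pow_const 2).aestronglyMeasurable ?_
    filter_upwards [hae hsum] with x hx
    rw [← hx, Real.norm_of_nonneg (sq_nonneg _)]
    linarith [sq_nonneg (deriv g x)]
  have hg2 : IntervalIntegrable (fun x => deriv g x ^ 2) volume 0 (2 * Real.pi) := by
    refine hsi.mono_fun' ((measurable_deriv g).pow_const 2).aestronglyMeasurable ?_
    filter_upwards [hae hsum] with x hx
    rw [← hx, Real.norm_of_nonneg (sq_nonneg _)]
    linarith [sq_nonneg (deriv f x)]
  have hf1 : f (2 * Real.pi) = -f 0 := by simp [hf, hψ0, hψ1, hper]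
  have hg0 : g 0 = 0 := by simp [hg, hψ0]
  have hg1 : g (2 * Real.pi) = 0 := by simp [hg, hψ1]
  obtain ⟨x₀, hx₀, hfx₀⟩ : ∃ x₀ ∈ Set.Icc 0 (2 * Real.pi), f x₀ = 0 := by
    have hc : ContinuousOn f (Set.Icc 0 (2 * Real.pi)) := hu ▸ hfac.continuousOn
    rcases le_total 0 (f 0) with h | h
    · exact intermediate_value_Icc' hpi2.le hc ⟨by rw [hf1]; linarith, h⟩
    · exact intermediate_value_Icc hpi2.le hc ⟨h, by rw [hf1]; linarith⟩
  have hW1 := wirtinger_of_zero hpi2 hfac hf2 hx₀ hfx₀ (by rw [hf1, neg_sq])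
  have hW2 := wirtinger_of_zero hpi2 hgac hg2 (Set.left_mem_Icc.2 hpi2.le) hg0 (by rw [hg0, hg1])
  have hconst : (Real.pi / (2 * Real.pi - 0)) ^ 2 = 1 / 4 := by
    field_simp
    ring
  rw [hconst] at hW1 hW2
  have hI1 : (∫ x in (0 : ℝ)..(2 * Real.pi), f x ^ 2) + ∫ x in (0 : ℝ)..(2 * Real.pi), g x ^ 2 =
      ∫ x in (0 : ℝ)..(2 * Real.pi), r x ^ 2 := by
    have if2 : IntervalIntegrable (fun x => f x ^ 2) volume 0 (2 * Real.pi) :=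
      (hfac.continuousOn.pow 2).intervalIntegrable
    have ig2 : IntervalIntegrable (fun x => g x ^ 2) volume 0 (2 * Real.pi) :=
      (hgac.continuousOn.pow 2).intervalIntegrable
    rw [← intervalIntegral.integral_add if2 ig2]
    congr 1
    funext x
    simp only [hf, hg]
    linear_combination r x ^ 2 * Real.sin_sq_add_cos_sq (ψ x)
  have hI2 : (∫ x in (0 : ℝ)..(2 * Real.pi), deriv f x ^ 2) +
      ∫ x in (0 : ℝ)..(2 * Real.pi), deriv g x ^ 2 =
      (∫ x in (0 : ℝ)..(2 * Real.pi), deriv r x ^ 2) +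
        1 / (4 * α ^ 2) * ∫ x in (0 : ℝ)..(2 * Real.pi), r x ^ 2 * p x ^ 2 := by
    rw [← intervalIntegral.integral_add hf2 hg2, ← intervalIntegral.integral_const_mul,
      ← intervalIntegral.integral_add hr2 (hp2.const_mul _)]
    refine intervalIntegral.integral_congr_ae ?_
    filter_upwards [hsum] with x hx hxm using hx (Set.uIoc_subset_uIcc hxm)
  have h1 : 1 / 4 * (∫ x in (0 : ℝ)..(2 * Real.pi), r x ^ 2) ≤
      (∫ x in (0 : ℝ)..(2 * Real.pi), deriv r x ^ 2) +
        1 / (4 * α ^ 2) * ∫ x in (0 : ℝ)..(2 * Real.pi), r x ^ 2 * p x ^ 2 := by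
    rw [← hI1, ← hI2]
    linarith
  have h2 := mul_le_mul_of_nonneg_left h1 (show 0 ≤ 4 * α ^ 2 by positivity)
  have h3 : 4 * α ^ 2 * ((∫ x in (0 : ℝ)..(2 * Real.pi), deriv r x ^ 2) +
      1 / (4 * α ^ 2) * ∫ x in (0 : ℝ)..(2 * Real.pi), r x ^ 2 * p x ^ 2) =
      4 * α ^ 2 * (∫ x in (0 : ℝ)..(2 * Real.pi), deriv r x ^ 2) +
        ∫ x in (0 : ℝ)..(2 * Real.pi), r x ^ 2 * p x ^ 2 := by
    field_simp
  linarith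

/-- The convex combination, with weights `4 α²` and `1 - 4 α² ≥ (q - 2) α²`, of a half-flux
inequality with potential energy `K` and of the Sobolev inequality. -/
theorem energy_lower_bound {q α K : ℝ} (hq : 2 < q) (hα : (q + 2) * α ^ 2 ≤ 1) {r : ℝ → ℝ}
    (hr : AbsolutelyContinuousOnInterval r 0 (2 * Real.pi)) (hper : r 0 = r (2 * Real.pi))
    (hr2 : IntervalIntegrable (fun x => deriv r x ^ 2) volume 0 (2 * Real.pi))
    (hr0 : ∀ x, 0 ≤ r x)
    (hK : α ^ 2 * (∫ x in (0 : ℝ)..(2 * Real.pi), r x ^ 2) ≤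
      4 * α ^ 2 * (∫ x in (0 : ℝ)..(2 * Real.pi), deriv r x ^ 2) + K) :
    α ^ 2 * ((2 * Real.pi) ^ (1 - 2 / q) *
        (∫ x in (0 : ℝ)..(2 * Real.pi), r x ^ q) ^ (2 / q)) ≤
      (∫ x in (0 : ℝ)..(2 * Real.pi), deriv r x ^ 2) + K := by
  have hS := mul_le_mul_of_nonneg_left (sobolev_circle hq hr hper hr2 hr0) (sq_nonneg α)
  have hD : 0 ≤ ∫ x in (0 : ℝ)..(2 * Real.pi), deriv r x ^ 2 :=
    intervalIntegral.integral_nonneg (by positivity) fun x _ => sq_nonneg _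
  have := mul_le_mul_of_nonneg_right hα hD
  nlinarith

theorem polarAdmissible_const (q α : ℝ) :
    PolarAdmissible q α (fun _ => 1) (fun x => α * x) := by
  have hd : deriv (fun x : ℝ => α * x) = fun _ => α := by
    funext x
    simp
  refine ⟨fun _ => zero_le_one, fun _ => rfl, ?_, by simp, fun a b => ?_, ?_, ?_⟩
  · exact (contDiff_const.contDiffOn).absolutelyContinuousOnInterval
  · exact ContDiffOn.absolutelyContinuousOnInterval (ContDiff.contDiffOn (by fun_prop))
  · rw [hd]; exact fun _ => rfl
  · simp [hd]

theorem J_const (α : ℝ) :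
    J (fun _ => 1) (fun x => α * x) = ENNReal.ofReal (2 * Real.pi * α ^ 2) := by
  have hd : deriv (fun x : ℝ => α * x) = fun _ => α := by
    funext x
    simp
  simp only [J, hd, deriv_const, lintegral_const, Measure.restrict_apply_univ, Real.volume_Ioc]
  rw [← ENNReal.ofReal_mul (by positivity)]
  congr 1
  ring

theorem J_ge {q α : ℝ} (hq : 2 < q) (hα : (q + 2) * α ^ 2 ≤ 1) {r φ : ℝ → ℝ}
    (h : PolarAdmissible q α r φ) : ENNReal.ofReal (2 * Real.pi * α ^ 2) ≤ J r φ := by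
  have hpi := Real.pi_pos
  have hpi2 : (0 : ℝ) ≤ 2 * Real.pi := by positivity
  rcases eq_or_ne α 0 with rfl | hα0
  · simp
  by_cases hJ : J r φ = ⊤
  · rw [hJ]; exact le_top
  have hrm : AEStronglyMeasurable r (volume.restrict (Set.Ioc 0 (2 * Real.pi))) := by
    have := h.r_absCont.continuousOn
    rw [Set.uIcc_of_le hpi2] at this
    exact (this.mono Set.Ioc_subset_Icc_self).aestronglyMeasurable measurableSet_Ioc
  have m1 : AEStronglyMeasurable (fun x => deriv r x ^ 2)
      (volume.restrict (Set.Ioc 0 (2 * Real.pi))) :=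
    ((measurable_deriv r).pow_const 2).aestronglyMeasurable
  have m2 : AEStronglyMeasurable (fun x => r x ^ 2 * deriv φ x ^ 2)
      (volume.restrict (Set.Ioc 0 (2 * Real.pi))) :=
    (hrm.pow 2).mul ((measurable_deriv φ).pow_const 2).aestronglyMeasurable
  have hnn : ∀ x, 0 ≤ deriv r x ^ 2 + r x ^ 2 * deriv φ x ^ 2 := fun x => by positivity
  have hint : Integrable (fun x => deriv r x ^ 2 + r x ^ 2 * deriv φ x ^ 2)
      (volume.restrict (Set.Ioc 0 (2 * Real.pi))) := by
    refine ⟨m1.add m2, ?_⟩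
    rw [hasFiniteIntegral_iff_ofReal (Filter.Eventually.of_forall hnn)]
    exact lt_top_iff_ne_top.2 hJ
  have i1 : IntervalIntegrable (fun x => deriv r x ^ 2) volume 0 (2 * Real.pi) := by
    rw [intervalIntegrable_iff_integrableOn_Ioc_of_le hpi2]
    refine hint.mono' m1 (Filter.Eventually.of_forall fun x => ?_)
    rw [Real.norm_of_nonneg (sq_nonneg _)]
    have : 0 ≤ r x ^ 2 * deriv φ x ^ 2 := by positivity
    linarith
  have i2 : IntervalIntegrable (fun x => r x ^ 2 * deriv φ x ^ 2) volume 0 (2 * Real.pi) := by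
    rw [intervalIntegrable_iff_integrableOn_Ioc_of_le hpi2]
    refine hint.mono' m2 (Filter.Eventually.of_forall fun x => ?_)
    rw [Real.norm_of_nonneg (by positivity)]
    have : 0 ≤ deriv r x ^ 2 := by positivity
    linarith
  have hper : r 0 = r (2 * Real.pi) := by simpa using (h.r_periodic 0).symm
  have hK := half_flux_inequality hα0 h.r_absCont hper i1
    (h.phi_absCont 0 (2 * Real.pi)).intervalIntegrable_deriv i2 h.phi_increment
  have hE := energy_lower_bound hq hα h.r_absCont hper i1 h.r_nonneg hK
  rw [h.r_normalized, ← Real.rpow_add (by positivity), sub_add_cancel, Real.rpow_one,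
    ← intervalIntegral.integral_add i1 i2, intervalIntegral.integral_of_le hpi2] at hE
  rw [J, ← ofReal_integral_eq_lintegral_ofReal hint (Filter.Eventually.of_forall hnn)]
  exact ENNReal.ofReal_le_ofReal (by linarith)

/-! ### The magnetic problem -/

section Polar

variable {u : ℝ → ℂ} {x : ℝ}

/-- Polar decomposition of the covariant derivative, multiplied by `|u|²` so that zeros of `u` are
allowed. -/
theorem normSq_mul_covariant (a : ℝ) (hu : DifferentiableAt ℝ u x)
    (hr : DifferentiableAt ℝ (fun y => ‖u y‖) x) :
    ‖u x‖ ^ 2 * ‖deriv u x + Complex.I * (a : ℂ) * u x‖ ^ 2 =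
      ‖u x‖ ^ 2 * deriv (fun y => ‖u y‖) x ^ 2 +
        ((starRingEnd ℂ) (u x) * (deriv u x + Complex.I * (a : ℂ) * u x)).im ^ 2 := by
  set r' := deriv (fun y => ‖u y‖) x with hr'
  set w := deriv u x + Complex.I * (a : ℂ) * u x with hw
  have h1 := hu.hasDerivAt.norm_sq.unique (hr.hasDerivAt.fun_pow 2)
  rw [Complex.inner] at h1
  have h2 : ((starRingEnd ℂ) (u x) * w).re = ‖u x‖ * r' := by
    have h3 : ((starRingEnd ℂ) (u x) * w).re = (deriv u x * (starRingEnd ℂ) (u x)).re := by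
      rw [hw]
      simp [Complex.mul_re, Complex.mul_im]
      ring
    rw [h3]
    simp only [Nat.cast_ofNat, Nat.add_one_sub_one, pow_one, ← hr'] at h1
    linarith
  have h4 : ‖(starRingEnd ℂ) (u x) * w‖ ^ 2 =
      ((starRingEnd ℂ) (u x) * w).re ^ 2 + ((starRingEnd ℂ) (u x) * w).im ^ 2 := by
    rw [Complex.sq_norm, Complex.normSq_apply]
    ring
  rw [norm_mul, RCLike.norm_conj, h2] at h4
  linear_combination h4

/-- Polar decomposition of the covariant derivative away from the zeros of `u`. -/
theorem covariant_sq_eq (a : ℝ) (hu : DifferentiableAt ℝ u x) (hux : u x ≠ 0) :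
    ‖deriv u x + Complex.I * (a : ℂ) * u x‖ ^ 2 =
      deriv (fun y => ‖u y‖) x ^ 2 + ‖u x‖ ^ 2 * ((deriv u x / u x).im + a) ^ 2 := by
  have hn : ‖u x‖ ≠ 0 := norm_ne_zero_iff.2 hux
  have h := normSq_mul_covariant a hu (hu.norm ℝ hux)
  have h1 : ((starRingEnd ℂ) (u x) * (deriv u x + Complex.I * (a : ℂ) * u x)).im =
      ‖u x‖ ^ 2 * ((deriv u x / u x).im + a) := by
    have h2 : (starRingEnd ℂ) (u x) * (deriv u x + Complex.I * (a : ℂ) * u x) =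
        ((‖u x‖ ^ 2 : ℝ) : ℂ) * (deriv u x / u x + Complex.I * a) := by
      rw [Complex.ofReal_pow, ← Complex.conj_mul']
      field_simp
    rw [h2, Complex.im_ofReal_mul]
    simp
  rw [h1] at h
  have h3 : ‖u x‖ ^ 2 ≠ 0 := pow_ne_zero 2 hn
  refine mul_left_cancel₀ h3 ?_
  rw [h]
  ring

/-- The **diamagnetic inequality**. -/
theorem diamagnetic (a : ℝ) (hu : DifferentiableAt ℝ u x) :
    deriv (fun y => ‖u y‖) x ^ 2 ≤ ‖deriv u x + Complex.I * (a : ℂ) * u x‖ ^ 2 := by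
  by_cases hux : u x = 0
  · have hmin : IsLocalMin (fun y => ‖u y‖) x :=
      Filter.Eventually.of_forall fun y => by simp [hux]
    rw [hmin.deriv_eq_zero, zero_pow two_ne_zero]
    positivity
  · rw [covariant_sq_eq a hu hux]
    have : 0 ≤ ‖u x‖ ^ 2 * ((deriv u x / u x).im + a) ^ 2 := by positivity
    linarith

end Polar

theorem intervalIntegrable_deriv_complex {u : ℝ → ℂ} {a b : ℝ}
    (hu : AbsolutelyContinuousOnInterval u a b) : IntervalIntegrable (deriv u) volume a b := by
  have hre : AbsolutelyContinuousOnInterval (fun x => (u x).re) a b :=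
    Complex.reCLM.lipschitz.comp_absolutelyContinuousOnInterval hu
  have him : AbsolutelyContinuousOnInterval (fun x => (u x).im) a b :=
    Complex.imCLM.lipschitz.comp_absolutelyContinuousOnInterval hu
  have h : IntervalIntegrable (fun x => ((deriv (fun x => (u x).re) x : ℝ) : ℂ) +
      ((deriv (fun x => (u x).im) x : ℝ) : ℂ) * Complex.I) volume a b := by
    have h1 := hre.intervalIntegrable_deriv
    have h2 := him.intervalIntegrable_deriv
    rw [intervalIntegrable_iff] at h1 h2 ⊢
    exact h1.ofReal.add (h2.ofReal.mul_const _)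
  refine h.congr_ae ?_
  refine (ae_restrict_iff' measurableSet_uIoc).2 ?_
  filter_upwards [complex_ae_differentiableAt hu] with x hx hxm
  have hd := (hx (Set.uIoc_subset_uIcc hxm)).hasDerivAt
  have h1 : deriv (fun x => (u x).re) x = (deriv u x).re :=
    (Complex.reCLM.hasFDerivAt.comp_hasDerivAt x hd).deriv
  have h2 : deriv (fun x => (u x).im) x = (deriv u x).im :=
    (Complex.imCLM.hasFDerivAt.comp_hasDerivAt x hd).deriv
  rw [h1, h2, Complex.re_add_im]

/-- The logarithmic derivative of a nowhere vanishing loop integrates to `2 π` times its winding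
number. -/
theorem exists_winding {u : ℝ → ℂ} {a b : ℝ} (hab : a ≤ b)
    (hu : AbsolutelyContinuousOnInterval u a b) (hper : u a = u b)
    (hne : ∀ x ∈ Set.Icc a b, u x ≠ 0) :
    IntervalIntegrable (fun x => (deriv u x / u x).im) volume a b ∧
      ∃ n : ℤ, ∫ x in a..b, (deriv u x / u x).im = 2 * Real.pi * n := by
  have huI : Set.uIcc a b = Set.Icc a b := Set.uIcc_of_le hab
  have hq : IntervalIntegrable (fun x => deriv u x / u x) volume a b := by
    simp_rw [div_eq_mul_inv]
    refine (intervalIntegrable_deriv_complex hu).mul_continuousOn ?_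
    exact hu.continuousOn.inv₀ fun x hx => hne x (huI ▸ hx)
  have hre : IntervalIntegrable (fun x => (deriv u x / u x).re) volume a b := by
    rw [intervalIntegrable_iff] at hq ⊢
    exact hq.re
  have him : IntervalIntegrable (fun x => (deriv u x / u x).im) volume a b := by
    rw [intervalIntegrable_iff] at hq ⊢
    exact hq.im
  refine ⟨him, ?_⟩
  set ρ : ℝ → ℝ := fun x => ∫ y in a..x, (deriv u y / u y).re with hρ
  set θ : ℝ → ℝ := fun x => ∫ y in a..x, (deriv u y / u y).im with hθ
  set z : ℝ → ℂ := fun x => (ρ x : ℂ) + Complex.I * (θ x : ℂ) with hz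
  have hofReal : ∀ {f : ℝ → ℝ}, AbsolutelyContinuousOnInterval f a b →
      AbsolutelyContinuousOnInterval (fun x => (f x : ℂ)) a b := fun hf =>
    Complex.ofRealCLM.lipschitz.comp_absolutelyContinuousOnInterval hf
  have hzac : AbsolutelyContinuousOnInterval z a b :=
    (hofReal (hre.absolutelyContinuousOnInterval_intervalIntegral Set.left_mem_uIcc)).fun_add
      ((hofReal (him.absolutelyContinuousOnInterval_intervalIntegral
        Set.left_mem_uIcc)).const_smul Complex.I)
  have hzd : ∀ᵐ x, x ∈ Set.uIcc a b → HasDerivAt z (deriv u x / u x) x := by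
    filter_upwards [hre.ae_hasDerivAt_integral, him.ae_hasDerivAt_integral] with x h1 h2 hx
    have h3 := (h1 hx a Set.left_mem_uIcc).ofReal_comp
    have h4 := (h2 hx a Set.left_mem_uIcc).ofReal_comp.const_mul Complex.I
    refine (h3.fun_add h4).congr_deriv ?_
    rw [mul_comm Complex.I, Complex.re_add_im]
  have hexp : AbsolutelyContinuousOnInterval (fun x => Complex.exp (-z x)) a b := by
    obtain ⟨C, hC⟩ := hzac.exists_bound
    have hcd : ContDiffOn ℝ 1 (fun y : ℂ => Complex.exp (-y)) (Metric.closedBall 0 C) :=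
      ContDiff.contDiffOn (Complex.contDiff_exp.comp contDiff_neg)
    obtain ⟨K, hK⟩ := hcd.exists_lipschitzOnWith one_ne_zero (convex_closedBall _ _)
      (isCompact_closedBall _ _)
    exact hK.comp_absolutelyContinuousOnInterval hzac fun x hx => by simpa using hC x hx
  have hE : AbsolutelyContinuousOnInterval (fun x => u x * Complex.exp (-z x)) a b :=
    hu.fun_smul hexp
  obtain ⟨C, hC⟩ := hE.const_of_ae_hasDerivAt_zero (by
    filter_upwards [complex_ae_differentiableAt hu, hzd] with x h1 h2 hx
    refine ((h1 hx).hasDerivAt.mul (h2 hx).fun_neg.cexp).congr_deriv ?_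
    have := hne x (huI ▸ hx)
    field_simp
    ring)
  have hza : z a = 0 := by simp [hz, hρ, hθ]
  have h1 := hC a Set.left_mem_uIcc
  have h2 := hC b Set.right_mem_uIcc
  rw [hza, neg_zero, Complex.exp_zero, mul_one] at h1
  rw [← h1, ← hper] at h2
  have h3 : Complex.exp (-z b) = 1 :=
    mul_left_cancel₀ (hne a ⟨le_rfl, hab⟩) (by rw [h2, mul_one])
  obtain ⟨n, hn⟩ := Complex.exp_eq_one_iff.1 h3
  refine ⟨-n, ?_⟩
  have h4 := congrArg Complex.im hn
  have h5 : (z b).im = θ b := by simp [hz]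
  have h6 : ((n : ℂ) * (2 * Real.pi * Complex.I)).im = n * (2 * Real.pi) := by
    simp [Complex.mul_im]
  rw [Complex.neg_im, h5, h6] at h4
  push_cast
  linarith

/-- The sharp lower bound for the magnetic energy of a loop. -/
theorem magnetic_lower_bound {q α : ℝ} (hq : 2 < q) (hα : (q + 2) * α ^ 2 ≤ 1) {A : ℝ → ℝ}
    (hA : IntervalIntegrable A volume 0 (2 * Real.pi)) {k : ℤ}
    (hk : ∫ x in (0 : ℝ)..(2 * Real.pi), A x = 2 * Real.pi * (α + k)) {u : ℝ → ℂ}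
    (hu : AbsolutelyContinuousOnInterval u 0 (2 * Real.pi)) (hper : u 0 = u (2 * Real.pi))
    (hw : IntervalIntegrable (fun x => ‖deriv u x + Complex.I * (A x : ℂ) * u x‖ ^ 2) volume 0
      (2 * Real.pi)) :
    α ^ 2 * ((2 * Real.pi) ^ (1 - 2 / q) *
        (∫ x in (0 : ℝ)..(2 * Real.pi), ‖u x‖ ^ q) ^ (2 / q)) ≤
      ∫ x in (0 : ℝ)..(2 * Real.pi), ‖deriv u x + Complex.I * (A x : ℂ) * u x‖ ^ 2 := by
  have hpi := Real.pi_pos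
  have hpi2 : (0 : ℝ) < 2 * Real.pi := by positivity
  have huI : Set.uIcc 0 (2 * Real.pi) = Set.Icc 0 (2 * Real.pi) := Set.uIcc_of_le hpi2.le
  set W : ℝ → ℝ := fun x => ‖deriv u x + Complex.I * (A x : ℂ) * u x‖ ^ 2 with hW
  have hWn : 0 ≤ ∫ x in (0 : ℝ)..(2 * Real.pi), W x :=
    intervalIntegral.integral_nonneg hpi2.le fun x _ => sq_nonneg _
  rcases eq_or_ne α 0 with rfl | hα0
  · simpa using hWn
  have hα1 : |α| < 1 / 2 := by
    have h1 := sq_nonneg α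
    have h2 : 0 < α ^ 2 := by positivity
    refine abs_lt_of_sq_lt_sq ?_ (by norm_num)
    nlinarith
  set r : ℝ → ℝ := fun x => ‖u x‖ with hr
  have hrac : AbsolutelyContinuousOnInterval r 0 (2 * Real.pi) :=
    lipschitzWith_one_norm.comp_absolutelyContinuousOnInterval hu
  have hrper : r 0 = r (2 * Real.pi) := by simp only [hr, hper]
  have hdia : ∀ᵐ x, x ∈ Set.uIcc 0 (2 * Real.pi) → deriv r x ^ 2 ≤ W x := by
    filter_upwards [complex_ae_differentiableAt hu] with x h1 hx
    exact diamagnetic (A x) (h1 hx)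
  have hr2 : IntervalIntegrable (fun x => deriv r x ^ 2) volume 0 (2 * Real.pi) := by
    refine hw.mono_fun' ((measurable_deriv r).pow_const 2).aestronglyMeasurable ?_
    refine (ae_restrict_iff' measurableSet_uIoc).2 ?_
    filter_upwards [hdia] with x hx hxm
    rw [Real.norm_of_nonneg (sq_nonneg _)]
    exact hx (Set.uIoc_subset_uIcc hxm)
  suffices hK : α ^ 2 * (∫ x in (0 : ℝ)..(2 * Real.pi), r x ^ 2) ≤
      4 * α ^ 2 * (∫ x in (0 : ℝ)..(2 * Real.pi), deriv r x ^ 2) +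
        ((∫ x in (0 : ℝ)..(2 * Real.pi), W x) -
          ∫ x in (0 : ℝ)..(2 * Real.pi), deriv r x ^ 2) by
    have := energy_lower_bound hq hα hrac hrper hr2 (fun x => norm_nonneg _) hK
    linarith
  by_cases hzero : ∃ x₀ ∈ Set.Icc 0 (2 * Real.pi), u x₀ = 0
  · obtain ⟨x₀, hx₀, hux₀⟩ := hzero
    have h1 := wirtinger_of_zero hpi2 hrac hr2 hx₀ (by simp [hr, hux₀]) (by rw [hrper])
    have hconst : (Real.pi / (2 * Real.pi - 0)) ^ 2 = 1 / 4 := by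
      field_simp
      ring
    rw [hconst] at h1
    have h2 : ∫ x in (0 : ℝ)..(2 * Real.pi), deriv r x ^ 2 ≤
        ∫ x in (0 : ℝ)..(2 * Real.pi), W x := by
      refine intervalIntegral.integral_mono_ae_restrict hpi2.le hr2 hw ?_
      refine (ae_restrict_iff' measurableSet_Icc).2 ?_
      filter_upwards [hdia] with x hx hxm using hx (huI ▸ hxm)
    have h3 := mul_le_mul_of_nonneg_left h1 (show 0 ≤ 4 * α ^ 2 by positivity)
    linarith
  · push Not at hzero
    obtain ⟨hωi, n, hn⟩ := exists_winding hpi2.le hu hper hzero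
    -- The flux is `α` modulo integers, hence at least `|α|` in modulus; scaling the phase down
    -- to the flux `α` does not increase the energy.
    set β : ℝ := α + (n + k : ℤ) with hβ
    have hβα : |α| ≤ |β| := by
      rcases eq_or_ne (n + k) 0 with h | h
      · rw [hβ, h]; simp
      · have h1 : (1 : ℝ) ≤ |((n + k : ℤ) : ℝ)| := by exact_mod_cast Int.one_le_abs h
        have h2 : |((n + k : ℤ) : ℝ)| ≤ |β| + |α| := by
          have : ((n + k : ℤ) : ℝ) = β - α := by rw [hβ]; ring
          rw [this]
          exact abs_sub _ _
        linarith
    have hβ0 : β ≠ 0 := by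
      intro h
      rw [h, abs_zero] at hβα
      exact hα0 (abs_nonpos_iff.1 hβα)
    set ω : ℝ → ℝ := fun x => (deriv u x / u x).im + A x with hω
    have hωint : ∫ x in (0 : ℝ)..(2 * Real.pi), ω x = 2 * Real.pi * β := by
      rw [intervalIntegral.integral_add hωi hA, hn, hk, hβ]
      push_cast
      ring
    have hpolar : ∀ᵐ x, x ∈ Set.uIcc 0 (2 * Real.pi) →
        W x = deriv r x ^ 2 + r x ^ 2 * ω x ^ 2 := by
      filter_upwards [complex_ae_differentiableAt hu] with x h1 hx
      exact covariant_sq_eq (A x) (h1 hx) (hzero x (huI ▸ hx))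
    have hpolar' : ∀ᵐ x ∂(volume.restrict (Set.uIoc 0 (2 * Real.pi))),
        W x - deriv r x ^ 2 = r x ^ 2 * ω x ^ 2 := by
      refine (ae_restrict_iff' measurableSet_uIoc).2 ?_
      filter_upwards [hpolar] with x hx hxm
      rw [hx (Set.uIoc_subset_uIcc hxm)]
      ring
    have hω2 : IntervalIntegrable (fun x => r x ^ 2 * ω x ^ 2) volume 0 (2 * Real.pi) :=
      (hw.sub hr2).congr_ae hpolar'
    have hωI : ∫ x in (0 : ℝ)..(2 * Real.pi), r x ^ 2 * ω x ^ 2 =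
        (∫ x in (0 : ℝ)..(2 * Real.pi), W x) - ∫ x in (0 : ℝ)..(2 * Real.pi), deriv r x ^ 2 := by
      rw [← intervalIntegral.integral_sub hw hr2]
      refine intervalIntegral.integral_congr_ae ?_
      have := (ae_restrict_iff' measurableSet_uIoc).1 hpolar'
      filter_upwards [this] with x hx hxm using (hx hxm).symm
    have hfun : (fun x => r x ^ 2 * (α / β * ω x) ^ 2) =
        fun x => (α / β) ^ 2 * (r x ^ 2 * ω x ^ 2) := by
      funext x; ring
    have hH := half_flux_inequality (p := fun x => α / β * ω x) hα0 hrac hrper hr2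
      ((hωi.add hA).const_mul _) (by rw [hfun]; exact hω2.const_mul _)
      (by rw [intervalIntegral.integral_const_mul, hωint]; field_simp)
    rw [hfun, intervalIntegral.integral_const_mul] at hH
    have hscale : (α / β) ^ 2 ≤ 1 := by
      rw [div_pow, div_le_one (by positivity)]
      exact sq_le_sq.2 hβα
    have hnn : 0 ≤ ∫ x in (0 : ℝ)..(2 * Real.pi), r x ^ 2 * ω x ^ 2 :=
      intervalIntegral.integral_nonneg hpi2.le fun x _ => by positivity
    rw [← hωI]
    nlinarith

/-- Every competitor has quotient at least `(2 π) ^ (1 / 2 - 1 / q) |α|`. -/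
theorem quotient_ge {q α : ℝ} (hq : 2 < q) (hα : (q + 2) * α ^ 2 ≤ 1) {A : ℝ → ℝ}
    (hA : IntervalIntegrable A volume 0 (2 * Real.pi)) {k : ℤ}
    (hk : ∫ x in (0 : ℝ)..(2 * Real.pi), A x = 2 * Real.pi * (α + k)) {u : ℝ → ℂ}
    (hu : IsCompetitor u) :
    ENNReal.ofReal ((2 * Real.pi) ^ (1 / 2 - 1 / q) * |α|) ≤ quotient q A u := by
  have hpi := Real.pi_pos
  have hpi2 : (0 : ℝ) < 2 * Real.pi := by positivity
  have hq0 : 0 < q := by linarith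
  have huI : Set.uIcc 0 (2 * Real.pi) = Set.Icc 0 (2 * Real.pi) := Set.uIcc_of_le hpi2.le
  have hper : u 0 = u (2 * Real.pi) := by simpa using (hu.periodic 0).symm
  have huc : ContinuousOn u (Set.Icc 0 (2 * Real.pi)) := huI ▸ hu.absCont.continuousOn
  have hum : AEStronglyMeasurable u (volume.restrict (Set.Ioc 0 (2 * Real.pi))) :=
    (huc.mono Set.Ioc_subset_Icc_self).aestronglyMeasurable measurableSet_Ioc
  have hp0 : ENNReal.ofReal q ≠ 0 := by simpa using hq0
  have hden : eLpNorm u (ENNReal.ofReal q) (volume.restrict (Set.Ioc 0 (2 * Real.pi))) ≠ 0 := by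
    rw [Ne, eLpNorm_eq_zero_iff hum hp0]
    intro h
    have h1 : u =ᵐ[volume.restrict (Set.Icc 0 (2 * Real.pi))] fun _ => 0 := by
      rw [← Measure.restrict_congr_set Ioc_ae_eq_Icc]; exact h
    have h2 := Measure.eqOn_Icc_of_ae_eq volume hpi2.ne h1 huc continuousOn_const
    refine hu.ne_zero (funext fun x => ?_)
    obtain ⟨y, hy, hxy⟩ := hu.periodic.exists_mem_Ico₀ hpi2 x
    rw [hxy]
    exact h2 ⟨hy.1, hy.2.le⟩
  have huL : MemLp u (ENNReal.ofReal q) (volume.restrict (Set.Ioc 0 (2 * Real.pi))) := by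
    obtain ⟨C, hC⟩ := isCompact_Icc.exists_bound_of_continuousOn huc
    exact MemLp.of_bound hum C ((ae_restrict_iff' measurableSet_Ioc).2
      (Filter.Eventually.of_forall fun x hx => hC x (Set.Ioc_subset_Icc_self hx)))
  rw [quotient, ENNReal.le_div_iff_mul_le (Or.inl hden) (Or.inl huL.eLpNorm_ne_top)]
  set w : ℝ → ℂ := fun x => deriv u x + Complex.I * (A x : ℂ) * u x with hw
  by_cases htop : eLpNorm w 2 (volume.restrict (Set.Ioc 0 (2 * Real.pi))) = ⊤
  · rw [htop]; exact le_top
  have hAm : AEStronglyMeasurable A (volume.restrict (Set.Ioc 0 (2 * Real.pi))) :=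
    ((intervalIntegrable_iff_integrableOn_Ioc_of_le hpi2.le).1 hA).aestronglyMeasurable
  have hwm : AEStronglyMeasurable w (volume.restrict (Set.Ioc 0 (2 * Real.pi))) :=
    (measurable_deriv u).aestronglyMeasurable.add
      (((Complex.continuous_ofReal.comp_aestronglyMeasurable hAm).const_mul Complex.I).mul hum)
  have hwL : MemLp w 2 (volume.restrict (Set.Ioc 0 (2 * Real.pi))) :=
    ⟨hwm, lt_top_iff_ne_top.2 htop⟩
  have hwi : IntervalIntegrable (fun x => ‖w x‖ ^ 2) volume 0 (2 * Real.pi) :=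
    (intervalIntegrable_iff_integrableOn_Ioc_of_le hpi2.le).2 (hwL.integrable_norm_pow two_ne_zero)
  have hmain := magnetic_lower_bound hq hα hA hk hu.absCont hper hwi
  rw [intervalIntegral.integral_of_le hpi2.le, intervalIntegral.integral_of_le hpi2.le] at hmain
  rw [hwL.eLpNorm_eq_integral_rpow_norm two_ne_zero ENNReal.ofNat_ne_top,
    huL.eLpNorm_eq_integral_rpow_norm hp0 ENNReal.ofReal_ne_top,
    ENNReal.toReal_ofReal hq0.le, ENNReal.toReal_ofNat, ← ENNReal.ofReal_mul (by positivity)]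
  refine ENNReal.ofReal_le_ofReal ?_
  set N := ∫ x in Set.Ioc 0 (2 * Real.pi), ‖u x‖ ^ q with hN
  have hN0 : 0 ≤ N := integral_nonneg fun x => Real.rpow_nonneg (norm_nonneg _) _
  have hsq : ∫ x in Set.Ioc 0 (2 * Real.pi), ‖w x‖ ^ (2 : ℝ) =
      ∫ x in Set.Ioc 0 (2 * Real.pi), ‖w x‖ ^ 2 := by
    simp_rw [Real.rpow_two]
  rw [hsq]
  have e : ((2 : ℝ))⁻¹ = 1 / 2 := by norm_num
  rw [e, ← Real.sqrt_eq_rpow]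
  refine Real.le_sqrt_of_sq_le (le_of_eq_of_le ?_ hmain)
  have e1 : ((2 * Real.pi) ^ (1 / 2 - 1 / q)) ^ 2 = (2 * Real.pi) ^ (1 - 2 / q) := by
    rw [← Real.rpow_mul_natCast hpi2.le]
    congr 1
    push_cast
    ring
  have e2 : (N ^ q⁻¹) ^ 2 = N ^ (2 / q) := by
    rw [← Real.rpow_mul_natCast hN0]
    congr 1
    push_cast
    ring
  rw [mul_pow, mul_pow, e1, e2, sq_abs]
  ring

/-- The gauge transform of a constant, which turns `A` into the constant `α`, has the quotient
`(2 π) ^ (1 / 2 - 1 / q) |α|`. -/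
theorem exists_quotient_eq {q α : ℝ} (hq : 2 < q) {A : ℝ → ℝ}
    (hA : IntervalIntegrable A volume 0 (2 * Real.pi)) {k : ℤ}
    (hk : ∫ x in (0 : ℝ)..(2 * Real.pi), A x = 2 * Real.pi * (α + k)) :
    ∃ u, IsCompetitor u ∧
      quotient q A u = ENNReal.ofReal ((2 * Real.pi) ^ (1 / 2 - 1 / q) * |α|) := by
  have hpi := Real.pi_pos
  have hpi2 : (0 : ℝ) < 2 * Real.pi := by positivity
  have hq0 : 0 < q := by linarith
  have huI : Set.uIcc 0 (2 * Real.pi) = Set.Icc 0 (2 * Real.pi) := Set.uIcc_of_le hpi2.le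
  set ψ : ℝ → ℝ := fun x => α * x - ∫ y in (0 : ℝ)..x, A y with hψ
  set g : ℝ → ℂ := fun x => Complex.exp (Complex.I * (ψ x : ℂ)) with hg
  set u : ℝ → ℂ := fun x => g (toIcoMod hpi2 0 x) with hu
  have hg0 : g 0 = 1 := by simp [hg, hψ]
  have hg1 : g (2 * Real.pi) = 1 := by
    have : Complex.I * (ψ (2 * Real.pi) : ℂ) = ((-k : ℤ) : ℂ) * (2 * Real.pi * Complex.I) := by
      simp only [hψ, hk]
      push_cast
      ring
    rw [hg]
    simp only
    rw [this, Complex.exp_int_mul_two_pi_mul_I]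
  have hnorm : ∀ x, ‖u x‖ = 1 := fun x => Complex.norm_exp_I_mul_ofReal _
  have hug : Set.EqOn u g (Set.Icc 0 (2 * Real.pi)) := by
    intro x hx
    rcases hx.2.eq_or_lt with h | h
    · have : toIcoMod hpi2 0 x = 0 := by
        rw [h]
        simpa using toIcoMod_add_right hpi2 0 (0 : ℝ)
      simp only [hu]
      rw [this, h, hg0, hg1]
    · simp only [hu]
      rw [(toIcoMod_eq_self hpi2).2 ⟨hx.1, by rwa [zero_add]⟩]
  have hψac : AbsolutelyContinuousOnInterval ψ 0 (2 * Real.pi) :=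
    (ContDiffOn.absolutelyContinuousOnInterval (ContDiff.contDiffOn (by fun_prop))).fun_sub
      (hA.absolutelyContinuousOnInterval_intervalIntegral Set.left_mem_uIcc)
  have hlip : LipschitzWith 1 fun t : ℝ => Complex.exp (Complex.I * (t : ℂ)) := by
    refine LipschitzWith.of_dist_le_mul fun s t => ?_
    have h1 : Complex.exp (Complex.I * (s : ℂ)) - Complex.exp (Complex.I * (t : ℂ)) =
        Complex.exp (Complex.I * (t : ℂ)) *
          (Complex.exp (Complex.I * ((s - t : ℝ) : ℂ)) - 1) := by
      rw [mul_sub, ← Complex.exp_add, mul_one]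
      congr 2
      push_cast
      ring
    rw [dist_eq_norm, h1, norm_mul, Complex.norm_exp_I_mul_ofReal, one_mul, NNReal.coe_one,
      one_mul, Real.dist_eq]
    exact Real.norm_exp_I_mul_ofReal_sub_one_le
  have hgac : AbsolutelyContinuousOnInterval g 0 (2 * Real.pi) :=
    hlip.comp_absolutelyContinuousOnInterval hψac
  refine ⟨u, ⟨fun x => ?_, absolutelyContinuousOnInterval_congr hgac (huI ▸ hug), fun h => ?_⟩, ?_⟩
  · simp only [hu]
    rw [toIcoMod_periodic hpi2 0 x]
  · have := hnorm 0
    rw [h] at this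
    simp at this
  have hae : ∀ᵐ x ∂(volume.restrict (Set.Ioc 0 (2 * Real.pi))),
      ‖deriv u x + Complex.I * (A x : ℂ) * u x‖ = ‖α‖ := by
    rw [← Measure.restrict_congr_set Ioo_ae_eq_Ioc]
    refine (ae_restrict_iff' measurableSet_Ioo).2 ?_
    filter_upwards [hA.ae_hasDerivAt_integral] with x hx hxm
    have hxm' : x ∈ Set.Icc 0 (2 * Real.pi) := Set.Ioo_subset_Icc_self hxm
    have h1 := hx (huI ▸ hxm') 0 Set.left_mem_uIcc
    have h2 : HasDerivAt ψ (α - A x) x := by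
      simpa using ((hasDerivAt_id x).const_mul α).fun_sub h1
    have h3 : HasDerivAt g (g x * (Complex.I * ((α - A x : ℝ) : ℂ))) x :=
      (h2.ofReal_comp.const_mul Complex.I).cexp
    have h4 : u =ᶠ[nhds x] g := by
      filter_upwards [Ioo_mem_nhds hxm.1 hxm.2] with y hy using hug (Set.Ioo_subset_Icc_self hy)
    rw [h4.deriv_eq, h3.deriv, ← hug hxm']
    have h5 : u x * (Complex.I * ((α - A x : ℝ) : ℂ)) + Complex.I * (A x : ℂ) * u x =
        Complex.I * (α : ℂ) * u x := by
      push_cast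
      ring
    rw [h5, norm_mul, norm_mul, hnorm, Complex.norm_I, one_mul, mul_one, Complex.norm_real]
  have hμ : (volume.restrict (Set.Ioc 0 (2 * Real.pi))) ≠ 0 := by
    rw [Ne, Measure.restrict_eq_zero, Real.volume_Ioc]
    simpa using hpi
  have hnum := eLpNorm_congr_norm_ae (p := 2) (g := fun _ => α) hae
  have hden := eLpNorm_congr_norm_ae (p := ENNReal.ofReal q)
    (μ := volume.restrict (Set.Ioc 0 (2 * Real.pi))) (f := u) (g := fun _ => (1 : ℝ))
    (Filter.Eventually.of_forall fun x => by rw [hnorm, norm_one])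
  rw [quotient, hnum, hden, eLpNorm_const _ two_ne_zero hμ,
    eLpNorm_const _ (by simpa using hq0) hμ, Measure.restrict_apply_univ, Real.volume_Ioc, sub_zero,
    ENNReal.toReal_ofReal hq0.le, ENNReal.toReal_ofNat, ENNReal.ofReal_rpow_of_pos hpi2,
    ENNReal.ofReal_rpow_of_pos hpi2, enorm_one, one_mul, Real.enorm_eq_ofReal_abs,
    ← ENNReal.ofReal_mul (abs_nonneg _), ← ENNReal.ofReal_div_of_pos (by positivity),
    Real.rpow_sub hpi2]
  congr 1
  ring

end Magnetic

end

theorem theorem2 (q α : ℝ) (hq : 2 < q) (hα : (q + 2) * α ^ 2 ≤ 1) :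
    (Magnetic.PolarAdmissible q α (fun _ => 1) (fun x => α * x) ∧
      ∀ r φ : ℝ → ℝ, Magnetic.PolarAdmissible q α r φ →
        Magnetic.J (fun _ => 1) (fun x => α * x) ≤ Magnetic.J r φ) ∧
    (∀ A : ℝ → ℝ, IntervalIntegrable A volume 0 (2 * Real.pi) →
      (∃ k : ℤ, Magnetic.mean A = α + k) →
        (∃ u : ℝ → ℂ, Magnetic.IsCompetitor u ∧
          Magnetic.quotient q A u = Magnetic.mu q A) ∧
        Magnetic.mu q A =
          ENNReal.ofReal ((2 * Real.pi) ^ (1 / 2 - 1 / q) * |α|)) := by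
  refine ⟨⟨Magnetic.polarAdmissible_const q α, fun r φ h => ?_⟩, ?_⟩
  · rw [Magnetic.J_const]
    exact Magnetic.J_ge hq hα h
  · rintro A hA ⟨k, hk⟩
    have hpi := Real.pi_pos
    have hk' : ∫ x in (0 : ℝ)..(2 * Real.pi), A x = 2 * Real.pi * (α + k) := by
      rw [← hk, Magnetic.mean]
      field_simp
    obtain ⟨u, hu, hqu⟩ := Magnetic.exists_quotient_eq hq hA hk'
    have hmu : Magnetic.mu q A = ENNReal.ofReal ((2 * Real.pi) ^ (1 / 2 - 1 / q) * |α|) := by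
      refine le_antisymm (hqu ▸ sInf_le ⟨u, hu, rfl⟩) (le_sInf ?_)
      rintro _ ⟨v, hv, rfl⟩
      exact Magnetic.quotient_ge hq hα hA hk' hv
    exact ⟨⟨u, hu, hqu.trans hmu.symm⟩, hmu⟩
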